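/- A composition $\alpha=(\alpha_1,\dots,\alpha_k)\vDash n$ is a list of positive integers with sum $|\alpha|=n$; $\ell(\alpha)=k$ is its length, and $\emptyset$ is the empty composition of $0$. Put $\mathrm{set}(\alpha)=\{\alpha_1,\alpha_1+\alpha_2,\dots,\alpha_1+\cdots+\alpha_{k-1}\}\subseteq[n-1]=\{1,\dots,n-1\}$, and for $S\subseteq[n-1]$ let $\mathrm{comp}(S)\vDash n$ be the composition with $\mathrm{set}(\mathrm{comp}(S))=S$. In commuting variables $x_1,x_2,\dots$, with coefficients in an arbitrary commutative ring, the fundamental quasisymmetric function of $\alpha\vDash n$ is $$F_\alpha=\sum_{\substack{i_1\le\cdots\le i_n\\ i_j=i_{j+1}\Rightarrow j\notin\mathrm{set}(\alpha)}}x_{i_1}\cdots x_{i_n}.$$ A standard immaculate tableau $T$ of shape $\alpha\vDash n$ is a bijective filling with $1,\dots,n$ of the left-justified diagram with $\alpha_i$ boxes in row $i$ from the bottom, such that the leftmost column increases from bottom to top and each row increases from left to right. Let $\mathrm{Des}(T)=\{i: i+1\text{ appears strictly above }i\text{ in }T\}$. The row-strict dual immaculate function is $\mathcal{R}\mathfrak{S}^*_\alpha=\sum_T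 F_{\mathrm{comp}(\mathrm{Des}(T)^c)}$, summed over all standard immaculate tableaux $T$ of shape $\alpha$, with complement taken in $[n-1]$. For an integer vector $\beta$ let $\mathrm{sgn}(\beta)=(-1)^{|\{i:\beta_i<0\}|}$. For $s>0$ and a composition $\alpha=(\alpha_1,\dots,\alpha_k)$ let $Z_{s,\alpha}$ be the set of all $\beta\in\mathbb{Z}^k$ such that 1. $\beta_1+\cdots+\beta_k=s$ and $\beta_1+\cdots+\beta_i\le s$ for all $i<k$; 2. $\alpha_i-\beta_i\ge0$ for all $i$, and $|\{i:\alpha_i-\beta_i=0\}|\le1$; 3. for all $1\le i\le k$, with $t_i=s-(\beta_1+\cdots+\beta_{i-1})$: if $\alpha_i>t_i$ then $0\le\beta_i\le t_i$; if $\alpha_i<t_i$ then $\beta_i<0$; and if $\alpha_i=t_i$ then either $\beta_i<0$, or $\beta_i=\alpha_i$ and $\beta_{i+1}=\cdots=\beta_k=0$. For compositions $\alpha,\gamma$ with $|\alpha|-|\gamma|=s>0$ and $k=\ell(\alpha)$, let $j\in\{1,\dots,k\}$ be the smallest integer such that $\alpha_i=\gamma_{i-1}$ for all $j<i\le k$ (this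 is used only when $\ell(\gamma)=k-1$), and let $r\in\{j,\dots,k\}$ be the largest integer such that $\alpha_j<\alpha_{j+1}<\cdots<\alpha_r$. Define $$c^{\gamma}_{s,\alpha}=\begin{cases}\mathrm{sgn}(\alpha-\gamma)&\text{if }\ell(\gamma)=\ell(\alpha)\text{ and }\alpha-\gamma\in Z_{s,\alpha},\\ \mathrm{sgn}(\alpha_1-\gamma_1,\dots,\alpha_{j-1}-\gamma_{j-1})&\text{if }\ell(\gamma)=\ell(\alpha)-1,\ r-j\text{ is even, and}\\&\ (\alpha_1-\gamma_1,\dots,\alpha_{j-1}-\gamma_{j-1},\alpha_j,0,\dots,0)\in Z_{s,\alpha},\\0&\text{otherwise.}\end{cases}$$ **Corollary (Pieri rule for row-strict dual immaculate functions).** Let $s>0$, let $(1^s)=(1,\dots,1)$ with $s$ parts, and let $\alpha$ be a composition (possibly empty). Then $$F_{(1^s)}\,\mathcal{R}\mathfrak{S}^*_\alpha=\sum_{\substack{\beta\vDash|\alpha|+s\\0\le\ell(\beta)-\ell(\alpha)\le1}}c^{\alpha}_{s,\beta}\,\mathcal{R}\mathfrak{S}^*_\beta .$$ -/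

import Mathlib

namespace DualImmaculate

/-- The set `set(α) = {α₁, α₁ + α₂, …, α₁ + ⋯ + α_{k-1}} ⊆ {1, …, n-1}` of a composition `α ⊨ n`.
The element `i : Fin (n - 1)` stands for the number `i + 1`. -/
def partialSumSet {n : ℕ} (α : Composition n) : Finset (Fin (n - 1)) :=
  compositionAsSetEquiv n (compositionEquiv n α)

/-- The composition `comp(S) ⊨ n` with `set(comp(S)) = S`, for `S ⊆ {1, …, n-1}`. -/
def comp {n : ℕ} (S : Finset (Fin (n - 1))) : Composition n :=
  (compositionEquiv n).symm ((compositionAsSetEquiv n).symm S)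

/-- The index sequences `i₁ ≤ ⋯ ≤ iₙ` over which the fundamental quasisymmetric function of `α` is
summed: `i_j = i_{j+1}` forces `j ∉ set(α)`. (Positions and values start at `0`.) -/
def IsFundamentalSeq {n : ℕ} (α : Composition n) (f : Fin n → ℕ) : Prop :=
  Monotone f ∧ ∀ j : Fin (n - 1),
    f ⟨j.1, by have := j.2; omega⟩ = f ⟨j.1 + 1, by have := j.2; omega⟩ → j ∉ partialSumSet α

/-- The fundamental quasisymmetric function
`F_α = ∑ x_{i₁} ⋯ x_{iₙ}`, a formal power series in countably many commuting variables:
the coefficient of a monomial `m` is the number of admissible sequences with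
`x_{i₁} ⋯ x_{iₙ} = m`. -/
noncomputable def fundamental (R : Type*) [CommRing R] {n : ℕ} (α : Composition n) :
    MvPowerSeries ℕ R :=
  fun m => (Nat.card {f : Fin n → ℕ //
    IsFundamentalSeq α f ∧ ∑ j, Finsupp.single (f j) 1 = m} : R)

/-- The boxes of the diagram of `α`: the box `⟨i, c⟩` is in row `i` from the bottom and in
column `c` from the left. -/
abbrev Cell {n : ℕ} (α : Composition n) : Type :=
  Σ i : Fin α.length, Fin (α.blocksFun i)

/-- A bijective filling of the diagram (the value `e : Fin n` stands for the entry `e + 1`) is a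
standard immaculate tableau if the leftmost column increases from bottom to top and each row
increases from left to right. -/
def IsSIT {n : ℕ} (α : Composition n) (T : Cell α ≃ Fin n) : Prop :=
  (∀ p q : Cell α, p.2.1 = 0 → q.2.1 = 0 → p.1 < q.1 → T p < T q) ∧
  (∀ i : Fin α.length, ∀ c d : Fin (α.blocksFun i), c < d → T ⟨i, c⟩ < T ⟨i, d⟩)

instance {n : ℕ} (α : Composition n) : DecidablePred (IsSIT α) := fun T => by
  unfold IsSIT; infer_instance

/-- The descent set of a filling: the entries `e` such that `e + 1` is strictly above `e`. -/
def descents {n : ℕ} (α : Composition n) (T : Cell α ≃ Fin n) : Finset (Fin (n - 1)) :=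
  Finset.univ.filter fun j =>
    (T.symm ⟨j.1, by have := j.2; omega⟩).1 < (T.symm ⟨j.1 + 1, by have := j.2; omega⟩).1

/-- The row-strict dual immaculate function: the sum of `F_{comp(Des(T)ᶜ)}` over all standard
immaculate tableaux `T` of shape `α`, the complement being taken in `{1, …, n-1}`. -/
noncomputable def rowStrictDualImmaculate (R : Type*) [CommRing R] {n : ℕ} (α : Composition n) :
    MvPowerSeries ℕ R :=
  ∑ T : Cell α ≃ Fin n with IsSIT α T, fundamental R (comp (descents α T)ᶜ)

/-- The set `Z_{s,α} ⊆ ℤᵏ` for an integer vector `α` of length `k`. -/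
def Z (s : ℕ) {k : ℕ} (α : Fin k → ℤ) : Set (Fin k → ℤ) :=
  {β | (∑ i, β i = s ∧ ∀ i, i.1 + 1 < k → ∑ l ∈ Finset.Iic i, β l ≤ s) ∧
    ((∀ i, 0 ≤ α i - β i) ∧ (Finset.univ.filter fun i => α i - β i = 0).card ≤ 1) ∧
    ∀ i,
      ((s - ∑ l ∈ Finset.Iio i, β l < α i) → 0 ≤ β i ∧ β i ≤ s - ∑ l ∈ Finset.Iio i, β l) ∧
      ((α i < s - ∑ l ∈ Finset.Iio i, β l) → β i < 0) ∧
      ((α i = s - ∑ l ∈ Finset.Iio i, β l) → β i < 0 ∨ (β i = α i ∧ ∀ l, i < l → β l = 0))}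

instance (s : ℕ) {k : ℕ} (α β : Fin k → ℤ) : Decidable (β ∈ Z s α) := by
  unfold Z; rw [Set.mem_ofPred_eq]; infer_instance

/-- `sgn(β) = (-1)^{neg(β)}`, where `neg(β)` is the number of negative entries of `β`. -/
def sgn {k : ℕ} (β : Fin k → ℤ) : ℤ :=
  (-1) ^ (Finset.univ.filter fun i => β i < 0).card

/-- The parts of a composition, as integers indexed from `0` (and `0` beyond the last part). -/
def part {n : ℕ} (α : Composition n) (i : ℕ) : ℤ := (α.blocks.getD i 0 : ℕ)

/-- The smallest `j` such that `α_i = γ_{i-1}` for all later indices `i` of `α`. Indices start at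
`0`, so this is one less than the index `j` for parts numbered from `1`. If `α` is not empty it is
at most the last index of `α`, because the condition is void there. -/
def jIndex {n m : ℕ} (γ : Composition n) (α : Composition m) : ℕ :=
  Nat.find (p := fun j => ∀ i < α.length, j < i → part α i = part γ (i - 1))
    ⟨α.length, fun _ h h' => absurd h (Nat.lt_asymm h')⟩

/-- The largest index `r ≥ j` of `α` with `α_j < α_{j+1} < ⋯ < α_r`, for `j = jIndex γ α`
(indices start at `0`). -/
def rIndex {n m : ℕ} (γ : Composition n) (α : Composition m) : ℕ :=
  Nat.findGreatest
    (fun r => jIndex γ α ≤ r ∧ ∀ i < r, jIndex γ α ≤ i → part α i < part α (i + 1))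
    (α.length - 1)

/-- The coefficient `c^γ_{s,α}`, for `|γ| = n` and `|α| = n + s`. -/
def pieriCoeff {n s : ℕ} (γ : Composition n) (α : Composition (n + s)) : ℤ :=
  if γ.length = α.length ∧
      (fun i : Fin α.length => part α i - part γ i) ∈ Z s (fun i : Fin α.length => part α i) then
    sgn (fun i : Fin α.length => part α i - part γ i)
  else if γ.length + 1 = α.length ∧ Even (rIndex γ α - jIndex γ α) ∧
      (fun i : Fin α.length =>
        if i.1 < jIndex γ α then part α i - part γ i
        else if i.1 = jIndex γ α then part α i else 0) ∈
        Z s (fun i : Fin α.length => part α i) then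
    sgn (fun i : Fin (jIndex γ α) => part α i - part γ i)
  else 0

end DualImmaculate

/-! Restricted to the variables x_0, …, x_{N-1}, the function F_{(1^s)} becomes the elementary
symmetric polynomial e_s. By standardization, the row-strict dual immaculate function of α becomes
the generating function of row-strict fillings: rows increase strictly, the leftmost column weakly
(`sum_isSIT_sum_isFundamentalSeq`). Each coefficient involves finitely many variables, so the rule
may be proved for every N separately.

The proof is by induction on N, removing all boxes with the largest entry. On tableaux this removal
is the functional `down` (`rowStrictSum_succ`); on the other factor it reads e_s ↦ e_s + x_N
e_{s-1}. The Pieri expansion is written as a recursion `skew` on rows from the bottom: either a new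
row of length s is inserted below everything, or the bottom row g is replaced by b with sign [s<b] -
[b<g], and s+g-b is passed on to the rows above. The relation `skew_down` between `skew` and `down`
has the same shape as the recursion for e_s, which gives `elemSymm_mul_rowStrictSum`. It rests on a
four-term identity of signs in `sum_pieriSign_smul`.

It remains to solve the recursion for the coefficients. The conditions defining `Z` can be checked
row by row (`mem_Z_succ`) and say that no sign vanishes. If a row is added, several places of
insertion may give the same shape; their contributions alternate along an increasing run, whence the
parity of r - j (`pieriRec_tail`). -/

namespace DualImmaculate

open Finset

/-! ### Deletion of the largest entry and the Pieri recursion, as functionals on functions of shapes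
-/

section Operators

variable {P : Type*} [CommRing P]

/-- Linear functional in `F`: the sum of `x ^ a * F γ` over all `γ` obtained from the shape `β` by
deleting the `a` boxes that may carry the largest entry of a row-strict tableau. -/
noncomputable def down (x : P) : List ℕ → ((List ℕ → P) →ₗ[P] P)
  | [] => LinearMap.proj []
  | g :: δ =>
    down x δ ∘ₗ LinearMap.funLeft P P (List.cons g) +
      (if 2 ≤ g then x • (down x δ ∘ₗ LinearMap.funLeft P P (List.cons (g - 1))) else 0) +
      (if g = 1 ∧ ∀ d ∈ δ, d = 1 then x ^ (δ.length + 1) • LinearMap.proj [] else 0)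

/-- The signs of the recursion for multiplication by an elementary symmetric function. -/
def pieriSign (s b g : ℕ) : ℤ := (if s < b then 1 else 0) - (if b < g then 1 else 0)

/-- Linear functional in `F`: the signed sum of `F β` over the shapes `β` in the Pieri rule
for the shape `γ`. -/
noncomputable def skew (P : Type*) [CommRing P] : ℕ → List ℕ → ((List ℕ → P) →ₗ[P] P)
  | s, [] => if s = 0 then LinearMap.proj [] else LinearMap.proj [s]
  | s, g :: γ =>
    (if s = 0 then 0 else LinearMap.proj (s :: g :: γ)) +
      ∑ i ∈ range (s + g), pieriSign s (i + 1) g •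
        (skew P (s + g - (i + 1)) γ ∘ₗ LinearMap.funLeft P P (List.cons (i + 1)))

theorem down_nil (x : P) (F : List ℕ → P) : down x [] F = F [] := rfl

theorem down_cons (x : P) (g : ℕ) (δ : List ℕ) (F : List ℕ → P) :
    down x (g :: δ) F = down x δ (fun l => F (g :: l)) +
      (if 2 ≤ g then x * down x δ (fun l => F ((g - 1) :: l)) else 0) +
      (if g = 1 ∧ ∀ d ∈ δ, d = 1 then x ^ (δ.length + 1) * F [] else 0) := by
  rw [down]
  simp only [LinearMap.add_apply]
  congr 1
  · congr 1
    split_ifs <;> rfl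
  · split_ifs <;> rfl

theorem skew_nil (s : ℕ) (F : List ℕ → P) :
    skew P s [] F = if s = 0 then F [] else F [s] := by
  rw [skew]; split_ifs <;> rfl

theorem skew_cons (s g : ℕ) (γ : List ℕ) (F : List ℕ → P) :
    skew P s (g :: γ) F = (if s = 0 then 0 else F (s :: g :: γ)) +
      ∑ i ∈ range (s + g), pieriSign s (i + 1) g •
        skew P (s + g - (i + 1)) γ (fun l => F ((i + 1) :: l)) := by
  rw [skew]
  simp only [LinearMap.add_apply, LinearMap.sum_apply]
  congr 1
  split_ifs <;> rfl

theorem down_congr (x : P) {β : List ℕ} (hβ : ∀ b ∈ β, 0 < b) {F G : List ℕ → P}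
    (h : ∀ l : List ℕ, (∀ b ∈ l, 0 < b) → F l = G l) : down x β F = down x β G := by
  induction β generalizing F G with
  | nil => exact h [] (by simp)
  | cons g δ ih =>
    simp only [List.forall_mem_cons] at hβ
    rw [down_cons, down_cons, h [] (by simp)]
    congr 2
    · exact ih hβ.2 fun l hl => h _ (by simpa using ⟨hβ.1, hl⟩)
    · split_ifs with hg
      · rw [ih hβ.2 fun l hl => h ((g - 1) :: l) (by
          simp only [List.forall_mem_cons]; exact ⟨by omega, hl⟩)]
      · rfl

theorem skew_congr (s : ℕ) {γ : List ℕ} (hγ : ∀ b ∈ γ, 0 < b) {F G : List ℕ → P}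
    (h : ∀ l : List ℕ, (∀ b ∈ l, 0 < b) → l.sum = γ.sum + s → F l = G l) :
    skew P s γ F = skew P s γ G := by
  induction γ generalizing s F G with
  | nil =>
    rw [skew_nil, skew_nil]
    split_ifs with hs
    · exact h [] (by simp) (by simp [hs])
    · exact h [s] (by simpa using Nat.pos_of_ne_zero hs) (by simp)
  | cons g δ ih =>
    have hγ' := hγ
    simp only [List.forall_mem_cons] at hγ
    rw [skew_cons, skew_cons]
    congr 1
    · split_ifs with hs
      · rfl
      · refine h _ ?_ (by simp; omega)
        rw [List.forall_mem_cons]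
        exact ⟨by omega, hγ'⟩
    · refine sum_congr rfl fun i hi => ?_
      rw [mem_range] at hi
      rw [ih (s + g - (i + 1)) hγ.2 fun l hl hl' => h ((i + 1) :: l) (by
        simp only [List.forall_mem_cons]; exact ⟨by omega, hl⟩) (by simp; omega)]

/-- When `down` deletes a one-box row, all rows above must be single boxes and vanish too, so
commuting it with `skew` requires `skew` on functions supported on one-column shapes. Only b = 1
contributes to the recursion. For g > 1 either the sign is zero or more than one box is passed on.
-/
theorem skew_ones (x : P) (c : P) (s : ℕ) {γ : List ℕ} (hγ : ∀ b ∈ γ, 0 < b) :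
    skew P s γ (fun l => if ∀ d ∈ l, d = 1 then x ^ l.length * c else 0) =
      if (∀ d ∈ γ, d = 1) ∧ s ≤ 1 then x ^ (γ.length + s) * c else 0 := by
  induction γ generalizing s c with
  | nil =>
    rw [skew_nil]
    rcases s with _ | _ | s <;> simp
  | cons g δ ih =>
    simp only [List.forall_mem_cons] at hγ
    have hF : ∀ (i : ℕ) (l : List ℕ), (fun l : List ℕ =>
        if ∀ d ∈ l, d = 1 then x ^ l.length * c else 0) (i :: l) =
          if i = 1 ∧ ∀ d ∈ l, d = 1 then x ^ l.length * (x * c) else 0 := by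
      intro i l
      simp only [List.forall_mem_cons, List.length_cons, pow_succ, mul_assoc]
    rw [skew_cons]
    simp only [hF]
    obtain ⟨n, hn⟩ : ∃ n, s + g = n + 1 := ⟨s + g - 1, by omega⟩
    rw [hn, sum_range_succ', sum_eq_zero, zero_add]
    · simp only [zero_add, true_and]
      rw [ih (x * c) _ hγ.2]
      have hn' : n + 1 - 1 = n := by omega
      rw [hn', pieriSign]
      by_cases hδ : ∀ d ∈ δ, d = 1
      · by_cases h0 : s = 0
        · subst h0
          by_cases hg : g = 1
          · obtain rfl : n = 0 := by omega
            subst hg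
            simp [eq_true hδ, pow_succ, mul_assoc]
          · have : 1 < g := by omega
            simp [hg, this]
        · by_cases hg : g = 1
          · subst hg
            by_cases hs : s = 1
            · subst hs
              simp [eq_true hδ, pow_succ, mul_assoc]
            · have : ¬ s ≤ 1 := by omega
              simp [h0, this, hs]
          · have : ¬ n ≤ 1 := by omega
            simp [hg, this]
      · simp [hδ]
    · intro i _
      simp [← Pi.zero_def]

end Operators

/-! ### Commutation of the Pieri recursion with deletion of the largest entry -/

section Commutation

variable {P : Type*} [CommRing P]

/-- Here `Y t b` stands for the value with bottom row b when t is passed on to the rows above. The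
two sides are compared as polynomials in x: the constant terms coincide, the quadratic terms agree
after shifting the arguments of the sign by one, and the linear terms need the identity `e5`. -/
theorem sum_pieriSign_smul (x : P) (s g : ℕ) (hg : 0 < g) (Y : ℕ → ℕ → P) :
    ∑ i ∈ range (s + g), pieriSign s (i + 1) g •
      (Y (s + g - (i + 1)) (i + 1) +
        (if s + g - (i + 1) = 0 then 0 else x * Y (s + g - (i + 1) - 1) (i + 1)) +
        (if 2 ≤ i + 1 then x * (Y (s + g - (i + 1)) (i + 1 - 1) +
          if s + g - (i + 1) = 0 then 0 else x * Y (s + g - (i + 1) - 1) (i + 1 - 1)) else 0)) =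
    ∑ i ∈ range (s + g), pieriSign s (i + 1) g • Y (s + g - (i + 1)) (i + 1) +
      (if 2 ≤ g then x * ∑ i ∈ range (s + (g - 1)),
        pieriSign s (i + 1) (g - 1) • Y (s + (g - 1) - (i + 1)) (i + 1) else 0) +
      (if s = 0 then 0 else x *
        (∑ i ∈ range (s - 1 + g), pieriSign (s - 1) (i + 1) g • Y (s - 1 + g - (i + 1)) (i + 1) +
          (if 2 ≤ g then x * ∑ i ∈ range (s - 1 + (g - 1)),
            pieriSign (s - 1) (i + 1) (g - 1) • Y (s - 1 + (g - 1) - (i + 1)) (i + 1)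
            else 0))) := by
  obtain ⟨n, hn⟩ : ∃ n, s + g = n + 1 := ⟨s + g - 1, by omega⟩
  have e1 : ∑ i ∈ range (n + 1), pieriSign s (i + 1) g •
      (if n + 1 - (i + 1) = 0 then 0 else x * Y (n + 1 - (i + 1) - 1) (i + 1)) =
      x * ∑ i ∈ range n, pieriSign s (i + 1) g • Y (n - (i + 1)) (i + 1) := by
    rw [sum_range_succ, mul_sum]
    simp only [Nat.sub_self, if_true, smul_zero, add_zero]
    refine sum_congr rfl fun i hi => ?_
    rw [mem_range] at hi
    rw [if_neg (by omega), mul_smul_comm]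
    congr 3
    omega
  have e2 : ∑ i ∈ range (n + 1), pieriSign s (i + 1) g •
      (if 2 ≤ i + 1 then x * (Y (n + 1 - (i + 1)) (i + 1 - 1) +
          if n + 1 - (i + 1) = 0 then 0 else x * Y (n + 1 - (i + 1) - 1) (i + 1 - 1)) else 0) =
      x * ∑ i ∈ range n, pieriSign s (i + 2) g • Y (n - (i + 1)) (i + 1) +
        x * (x * ∑ i ∈ range (n - 1), pieriSign s (i + 2) g • Y (n - 1 - (i + 1)) (i + 1)) := by
    rw [sum_range_succ']
    simp only [zero_add, Nat.reduceLeDiff, if_false, smul_zero, add_zero]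
    rw [← mul_add, mul_sum (range (n - 1)) _ x]
    have : ∑ i ∈ range (n - 1), x * (pieriSign s (i + 2) g • Y (n - 1 - (i + 1)) (i + 1)) =
        ∑ i ∈ range n, pieriSign s (i + 2) g •
          (if n - (i + 1) = 0 then 0 else x * Y (n - (i + 1) - 1) (i + 1)) := by
      rcases n with _ | n
      · simp
      · rw [sum_range_succ]
        simp only [Nat.sub_self, if_true, smul_zero, add_zero]
        refine sum_congr rfl fun i hi => ?_
        rw [mem_range] at hi
        rw [if_neg (by omega), mul_smul_comm]
        congr 3
        omega
    rw [this, ← sum_add_distrib, mul_sum]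
    refine sum_congr rfl fun i hi => ?_
    have h1 : n + 1 - (i + 1 + 1) = n - (i + 1) := by omega
    rw [if_pos trivial, ← smul_add, mul_smul_comm, h1, Nat.add_sub_cancel]
  have e3 : (if 2 ≤ g then x * ∑ i ∈ range (s + (g - 1)),
        pieriSign s (i + 1) (g - 1) • Y (s + (g - 1) - (i + 1)) (i + 1) else 0) =
      x * ∑ i ∈ range n, pieriSign s (i + 1) (g - 1) • Y (n - (i + 1)) (i + 1) := by
    have h : s + (g - 1) = n := by omega
    rw [h]
    split_ifs with h2
    · rfl
    -- Here g = 1 and n = s, so b ≤ s and every sign is zero; the sum can be kept without its case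
    -- condition.
    · rw [sum_eq_zero, mul_zero]
      intro i hi
      rw [mem_range] at hi
      have : pieriSign s (i + 1) (g - 1) = 0 := by
        rw [pieriSign, if_neg (by omega), if_neg (by omega), sub_zero]
      rw [this, zero_smul]
  have e4 : (if s = 0 then 0 else x *
        (∑ i ∈ range (s - 1 + g), pieriSign (s - 1) (i + 1) g • Y (s - 1 + g - (i + 1)) (i + 1) +
          (if 2 ≤ g then x * ∑ i ∈ range (s - 1 + (g - 1)),
            pieriSign (s - 1) (i + 1) (g - 1) • Y (s - 1 + (g - 1) - (i + 1)) (i + 1)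
            else 0))) =
      x * ∑ i ∈ range n, pieriSign s (i + 2) (g + 1) • Y (n - (i + 1)) (i + 1) +
        x * (x * ∑ i ∈ range (n - 1), pieriSign s (i + 2) g • Y (n - 1 - (i + 1)) (i + 1)) := by
    split_ifs with hs h2
    · rw [sum_eq_zero, sum_eq_zero]
      · simp
      · intro i hi
        rw [mem_range] at hi
        have : pieriSign s (i + 2) g = 0 := by
          rw [pieriSign, if_pos (by omega), if_pos (by omega), sub_self]
        rw [this, zero_smul]
      · intro i hi
        rw [mem_range] at hi
        have : pieriSign s (i + 2) (g + 1) = 0 := by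
          rw [pieriSign, if_pos (by omega), if_pos (by omega), sub_self]
        rw [this, zero_smul]
    · have h : s - 1 + g = n := by omega
      have h' : s - 1 + (g - 1) = n - 1 := by omega
      rw [h, h', mul_add]
      have hs1 : ∀ i, pieriSign (s - 1) (i + 1) g = pieriSign s (i + 2) (g + 1) := by
        intro i
        rw [pieriSign, pieriSign]
        congr 2 <;> apply propext <;> omega
      have hs2 : ∀ i, pieriSign (s - 1) (i + 1) (g - 1) = pieriSign s (i + 2) g := by
        intro i
        rw [pieriSign, pieriSign]
        congr 2 <;> apply propext <;> omega
      simp only [hs1, hs2]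
    · have h : s - 1 + g = n := by omega
      rw [h, add_zero, sum_eq_zero (s := range (n - 1)), mul_zero, mul_zero, add_zero]
      · have hs1 : ∀ i, pieriSign (s - 1) (i + 1) g = pieriSign s (i + 2) (g + 1) := by
          intro i
          rw [pieriSign, pieriSign]
          congr 2 <;> apply propext <;> omega
        simp only [hs1]
      · intro i hi
        rw [mem_range] at hi
        have : pieriSign s (i + 2) g = 0 := by
          rw [pieriSign, if_neg (by omega), if_neg (by omega), sub_zero]
        rw [this, zero_smul]
  -- With b = i + 1, the terms comparing s with b and b + 1 are the same on both sides; the others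
  -- are exchanged by b+1 < g ⇔ b < g-1 and b < g ⇔ b+1 < g+1.
  have e5 : ∑ i ∈ range n, pieriSign s (i + 1) g • Y (n - (i + 1)) (i + 1) +
      ∑ i ∈ range n, pieriSign s (i + 2) g • Y (n - (i + 1)) (i + 1) =
      ∑ i ∈ range n, pieriSign s (i + 1) (g - 1) • Y (n - (i + 1)) (i + 1) +
      ∑ i ∈ range n, pieriSign s (i + 2) (g + 1) • Y (n - (i + 1)) (i + 1) := by
    rw [← sum_add_distrib, ← sum_add_distrib]
    refine sum_congr rfl fun i _ => ?_
    rw [← add_smul, ← add_smul]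
    congr 1
    have h1 : i + 2 < g ↔ i + 1 < g - 1 := by omega
    have h2 : i + 2 < g + 1 ↔ i + 1 < g := by omega
    simp only [pieriSign, h1, h2]
    ring
  rw [e3, e4, hn]
  simp only [smul_add, sum_add_distrib]
  rw [e1, e2]
  linear_combination x * e5

/-- This mirrors e_s ↦ e_s + x e_{s-1}. By induction on the rows, the generic terms match by
`sum_pieriSign_smul`. What remains are the inserted bottom row and the one-column corrections,
settled by the cases s = 0, 1, ≥ 2 and g = 1, ≥ 2. -/
theorem skew_down (x : P) (s : ℕ) {γ : List ℕ} (hγ : ∀ b ∈ γ, 0 < b) (F : List ℕ → P) :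
    skew P s γ (fun β => down x β F) = down x γ (fun δ => skew P s δ F) +
      if s = 0 then 0 else x * down x γ (fun δ => skew P (s - 1) δ F) := by
  induction γ generalizing s F with
  | nil =>
    simp only [skew_nil, down_cons, down_nil]
    rcases s with _ | _ | s <;> simp
  | cons g γ ih =>
    simp only [List.forall_mem_cons] at hγ
    obtain ⟨hg, hγ⟩ := hγ
    set Y : ℕ → ℕ → P := fun t b => down x γ (fun δ => skew P t δ (fun l => F (b :: l))) with hY
    have term : ∀ t b, skew P t γ (fun l => down x (b :: l) F) =
        (Y t b + (if t = 0 then 0 else x * Y (t - 1) b) +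
          (if 2 ≤ b then x * (Y t (b - 1) + if t = 0 then 0 else x * Y (t - 1) (b - 1)) else 0)) +
        (if b = 1 then (if (∀ d ∈ γ, d = 1) ∧ t ≤ 1 then
          x ^ (γ.length + t) * (x * F []) else 0) else 0) := by
      intro t b
      have hsplit : (fun l => down x (b :: l) F) =
          (fun l => down x l (fun l' => F (b :: l'))) +
          (if 2 ≤ b then x • (fun l => down x l (fun l' => F ((b - 1) :: l'))) else 0) +
          (if b = 1 then (fun l => if ∀ d ∈ l, d = 1 then x ^ l.length * (x * F []) else 0)
            else 0) := by
        funext l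
        rw [down_cons]
        by_cases hb : b = 1 <;> by_cases hb2 : 2 ≤ b <;>
          simp [hb, hb2, pow_succ, mul_assoc]
      rw [hsplit, map_add, map_add, ih t hγ]
      congr 1
      · congr 1
        split_ifs with h1 h2
        · rw [map_smul, ih t hγ, if_pos h2, smul_eq_mul]
        · rw [map_smul, ih t hγ, if_neg h2, smul_eq_mul]
        · rw [map_zero]
      · by_cases hb : b = 1
        · rw [if_pos hb, if_pos hb, skew_ones _ _ _ hγ]
        · rw [if_neg hb, if_neg hb, map_zero]
    have inner : ∀ t b, down x γ (fun δ => skew P t (b :: δ) F) =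
        (if t = 0 then 0 else down x γ (fun l => F (t :: b :: l))) +
          ∑ i ∈ range (t + b), pieriSign t (i + 1) b • Y (t + b - (i + 1)) (i + 1) := by
      intro t b
      have hsplit : (fun δ => skew P t (b :: δ) F) =
          (if t = 0 then 0 else (fun l => F (t :: b :: l))) +
          ∑ i ∈ range (t + b), pieriSign t (i + 1) b •
            (fun δ => skew P (t + b - (i + 1)) δ (fun l => F ((i + 1) :: l))) := by
        funext l
        rw [skew_cons, Pi.add_apply, Finset.sum_apply]
        congr 1
        split_ifs <;> rfl
      rw [hsplit, map_add, map_sum]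
      congr 1
      · split_ifs
        · rw [map_zero]
        · rfl
      · exact sum_congr rfl fun i _ => map_zsmul _ _ _
    -- For g = 1 and s > 0 the sign of b = 1 is zero; for g > 1 `skew_ones` or the sign gives zero.
    -- Only s = 0, g = 1 survives.
    have side : ∑ i ∈ range (s + g), pieriSign s (i + 1) g •
        (if i + 1 = 1 then (if (∀ d ∈ γ, d = 1) ∧ s + g - (i + 1) ≤ 1 then
          x ^ (γ.length + (s + g - (i + 1))) * (x * F []) else 0) else 0) =
        if s = 0 ∧ g = 1 ∧ ∀ d ∈ γ, d = 1 then x ^ (γ.length + 1) * F [] else 0 := by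
      obtain ⟨n, hn⟩ : ∃ n, s + g = n + 1 := ⟨s + g - 1, by omega⟩
      rw [hn, sum_range_succ', sum_eq_zero (fun i _ => by simp)]
      simp only [zero_add, if_true, Nat.add_sub_cancel]
      by_cases ho : ∀ d ∈ γ, d = 1
      · simp only [eq_true ho, true_and, and_true]
        by_cases hs : s = 0
        · subst hs
          by_cases hg1 : g = 1
          · obtain rfl : n = 0 := by omega
            simp [hg1, pieriSign, pow_succ, mul_assoc]
          · have : 1 < g := by omega
            simp [hg1, pieriSign, this]
        · by_cases hg1 : g = 1
          · have : ¬ s < 1 := by omega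
            simp [hg1, pieriSign, this, hs]
          · have : ¬ n ≤ 1 := by omega
            simp [this, hs]
      · simp [ho]
    rw [skew_cons]
    simp only [term]
    simp only [smul_add _ (_ + _ + _), sum_add_distrib (f := fun i => pieriSign s (i + 1) g • (_ + _ + _))]
    rw [sum_pieriSign_smul x s g hg Y, side]
    simp only [down_cons x g γ, inner, skew_nil]
    rcases s with _ | s
    · by_cases h2 : 2 ≤ g
      · have h1 : g ≠ 1 := by omega
        simp [h1]
      · obtain rfl : g = 1 := by omega
        simp
    · simp only [down_cons, Nat.add_sub_cancel]
      by_cases h2 : 2 ≤ g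
      · have h1 : g ≠ 1 := by omega
        rcases s with _ | s
        · simp [h1, h2]
          ring
        · simp [h1, h2]
          ring
      · obtain rfl : g = 1 := by omega
        rcases s with _ | s
        · by_cases ho : ∀ d ∈ γ, d = 1
          · simp [eq_true ho]
            ring
          · simp [ho]
            ring
        · by_cases ho : ∀ d ∈ γ, d = 1
          · simp [eq_true ho]
            ring
          · simp [ho]
            ring

end Commutation

/-! ### Row-strict tableaux and elementary symmetric polynomials in finitely many variables -/

section Tableaux

variable {P : Type*} [CommRing P]

/-- The generating function of the row-strict tableaux of shape `β` with entries in `[v, N)`,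
a tableau being given by the sets of entries of its rows: the minima of the rows increase weakly. -/
noncomputable def rowStrictSum (x : ℕ → P) (N : ℕ) : ℕ → List ℕ → P
  | _, [] => 1
  | v, b :: β => ∑ X ∈ powersetCard b (Ico v N),
      (∏ i ∈ X, x i) * rowStrictSum x N (sInf (X : Set ℕ)) β

/-- Only the entry N is available, and a strict row can use it once. This accounts for the last
summand of `down`. -/
theorem rowStrictSum_top (x : ℕ → P) (N : ℕ) {β : List ℕ} (hβ : ∀ b ∈ β, 0 < b) :
    rowStrictSum x (N + 1) N β = if ∀ d ∈ β, d = 1 then x N ^ β.length else 0 := by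
  induction β with
  | nil => simp [rowStrictSum]
  | cons b β ih =>
    simp only [List.forall_mem_cons] at hβ
    rw [rowStrictSum, Nat.Ico_succ_singleton]
    by_cases hb : b = 1
    · subst hb
      have : powersetCard 1 {N} = {{N}} := by
        conv_lhs => rw [← card_singleton N]
        exact powersetCard_self _
      rw [this, sum_singleton, prod_singleton, coe_singleton, csInf_singleton, ih hβ.2]
      by_cases ho : ∀ d ∈ β, d = 1
      · simp [eq_true ho, pow_succ']
      · simp [ho]
    · rw [powersetCard_eq_empty.2 (by rw [card_singleton]; omega)]
      simp [hb]

theorem sInf_coe_insert {N : ℕ} {X : Finset ℕ} (hX : X.Nonempty) (h : ∀ i ∈ X, i < N) :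
    sInf ((insert N X : Finset ℕ) : Set ℕ) = sInf (X : Set ℕ) := by
  rw [coe_insert, csInf_insert (OrderBot.bddBelow _) hX]
  exact inf_eq_right.2 (h _ (mem_coe.1 (Nat.sInf_mem (coe_nonempty.2 hX)))).le

/-- The bottom row is split by whether it contains N. Removing N from a row with another entry
leaves its minimum unchanged, so the bound on the rows above is the same. If N is the only entry,
the bound becomes N and the rows above are forced. -/
theorem rowStrictSum_succ (x : ℕ → P) (N v : ℕ) (hv : v ≤ N) {β : List ℕ}
    (hβ : ∀ b ∈ β, 0 < b) :
    rowStrictSum x (N + 1) v β = down (x N) β (rowStrictSum x N v) := by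
  induction β generalizing v with
  | nil => simp [rowStrictSum, down_nil]
  | cons b β ih =>
    simp only [List.forall_mem_cons] at hβ
    obtain ⟨b, rfl⟩ : ∃ c, b = c + 1 := ⟨b - 1, by omega⟩
    have hdown : ∀ c, down (x N) β (fun l => rowStrictSum x N v (c :: l)) =
        ∑ X ∈ powersetCard c (Ico v N), (∏ i ∈ X, x i) *
          down (x N) β (rowStrictSum x N (sInf (X : Set ℕ))) := by
      intro c
      have : (fun l => rowStrictSum x N v (c :: l)) = ∑ X ∈ powersetCard c (Ico v N),
          (∏ i ∈ X, x i) • rowStrictSum x N (sInf (X : Set ℕ)) := by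
        funext l
        rw [rowStrictSum, Finset.sum_apply]
        rfl
      rw [this, map_sum]
      exact sum_congr rfl fun X _ => by rw [map_smul, smul_eq_mul]
    have hlt : ∀ {c : ℕ} {X : Finset ℕ}, X ∈ powersetCard c (Ico v N) → ∀ i ∈ X, i < N :=
      fun hX i hi => (mem_Ico.1 ((mem_powersetCard.1 hX).1 hi)).2
    have hne : ∀ {c : ℕ} {X : Finset ℕ}, X ∈ powersetCard (c + 1) (Ico v N) → X.Nonempty :=
      fun hX => card_pos.1 (by rw [(mem_powersetCard.1 hX).2]; omega)
    have hle : ∀ {c : ℕ} {X : Finset ℕ}, X ∈ powersetCard (c + 1) (Ico v N) →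
        sInf (X : Set ℕ) ≤ N :=
      fun hX => (hlt hX _ (mem_coe.1 (Nat.sInf_mem (coe_nonempty.2 (hne hX))))).le
    have hN : N ∉ Ico v N := by simp
    rw [rowStrictSum, Nat.Ico_succ_right_eq_insert_Ico hv, powersetCard_succ_insert hN,
      sum_union, sum_image, down_cons, hdown, hdown, Nat.add_sub_cancel, add_assoc]
    · congr 1
      · exact sum_congr rfl fun X hX => by rw [ih _ (hle hX) hβ.2]
      · rcases b with _ | b
        · simp only [powersetCard_zero, sum_singleton, insert_empty_eq, prod_singleton,
            coe_singleton, csInf_singleton]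
          rw [rowStrictSum_top x N hβ.2]
          by_cases ho : ∀ d ∈ β, d = 1
          · simp [eq_true ho, pow_succ', rowStrictSum]
          · simp [ho]
        · rw [if_pos (by omega), if_neg (by omega), add_zero, mul_sum]
          refine sum_congr rfl fun X hX => ?_
          rw [sInf_coe_insert (hne hX) (hlt hX), ih _ (hle hX) hβ.2, prod_insert, mul_assoc]
          exact fun h => absurd (hlt hX N h) (lt_irrefl N)
    · intro X hX Y hY h
      have h1 : N ∉ X := fun h => absurd (hlt (mem_coe.1 hX) N h) (lt_irrefl N)
      have h2 : N ∉ Y := fun h => absurd (hlt (mem_coe.1 hY) N h) (lt_irrefl N)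
      rw [← erase_insert h1, ← erase_insert h2]
      exact congrArg (fun Z => Finset.erase Z N) h
    · rw [disjoint_left]
      intro X hX hX'
      obtain ⟨Y, -, rfl⟩ := mem_image.1 hX'
      exact absurd (hlt hX N (mem_insert_self _ _)) (lt_irrefl N)

/-- The elementary symmetric polynomial of degree `s` in `x 0, …, x (N - 1)`. -/
noncomputable def elemSymm (x : ℕ → P) (s N : ℕ) : P :=
  ∑ X ∈ powersetCard s (Ico 0 N), ∏ i ∈ X, x i

theorem elemSymm_succ (x : ℕ → P) (s N : ℕ) : elemSymm x s (N + 1) =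
    elemSymm x s N + if s = 0 then 0 else x N * elemSymm x (s - 1) N := by
  rcases s with _ | s
  · simp [elemSymm]
  · have hlt : ∀ {c : ℕ} {X : Finset ℕ}, X ∈ powersetCard c (Ico 0 N) → N ∉ X :=
      fun hX hN => lt_irrefl N (mem_Ico.1 ((mem_powersetCard.1 hX).1 hN)).2
    have hN : N ∉ Ico 0 N := by simp
    rw [elemSymm, Nat.Ico_succ_right_eq_insert_Ico (Nat.zero_le N), powersetCard_succ_insert hN,
      sum_union, sum_image, if_neg (by omega), Nat.add_sub_cancel, elemSymm, elemSymm, mul_sum]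
    · congr 1
      exact sum_congr rfl fun X hX => prod_insert (hlt hX)
    · intro X hX Y hY h
      rw [← erase_insert (hlt (mem_coe.1 hX)), ← erase_insert (hlt (mem_coe.1 hY))]
      exact congrArg (fun Z => Finset.erase Z N) h
    · rw [disjoint_left]
      intro X hX hX'
      obtain ⟨Y, -, rfl⟩ := mem_image.1 hX'
      exact hlt hX (mem_insert_self _ _)

/-- Both sides obey the same recursion in N: `skew_down` moves the deletion of the largest entry
outside `skew`, and the induction hypothesis, applied to all shapes under `down`, turns `skew` back
into products. Without variables only the empty shape has a filling. -/
theorem elemSymm_mul_rowStrictSum (x : ℕ → P) (s N : ℕ) {γ : List ℕ} (hγ : ∀ b ∈ γ, 0 < b) :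
    elemSymm x s N * rowStrictSum x N 0 γ = skew P s γ (rowStrictSum x N 0) := by
  induction N generalizing s γ with
  | zero =>
    have h0 : ∀ b l, 0 < b → rowStrictSum x 0 0 (b :: l) = 0 := by
      intro b l hb
      rw [rowStrictSum, Ico_self, powersetCard_eq_empty.2 (by simpa using hb), sum_empty]
    rcases γ with _ | ⟨g, γ⟩
    · rw [skew_nil]
      split_ifs with hs
      · subst hs
        simp [elemSymm, rowStrictSum]
      · rw [h0 _ _ (by omega), elemSymm, Ico_self,
          powersetCard_eq_empty.2 (by simp; omega), sum_empty, zero_mul]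
    · simp only [List.forall_mem_cons] at hγ
      rw [h0 _ _ hγ.1, mul_zero, skew_cons, sum_eq_zero, add_zero]
      · split_ifs with hs
        · rfl
        · exact (h0 _ _ (by omega)).symm
      · intro i _
        have : (fun l => rowStrictSum x 0 0 ((i + 1) :: l)) = 0 :=
          funext fun l => h0 _ _ (by omega)
        rw [this, map_zero, smul_zero]
  | succ N ih =>
    have hmul : ∀ t, down (x N) γ (fun δ => skew P t δ (rowStrictSum x N 0)) =
        elemSymm x t N * down (x N) γ (rowStrictSum x N 0) := by
      intro t
      rw [← smul_eq_mul, ← map_smul]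
      exact down_congr (x N) hγ fun l hl => (ih t hl).symm
    rw [skew_congr s hγ fun l hl _ => rowStrictSum_succ x N 0 (Nat.zero_le N) hl,
      skew_down (x N) s hγ, hmul, hmul, elemSymm_succ, rowStrictSum_succ x N 0 (Nat.zero_le N) hγ]
    split_ifs
    · ring
    · ring

end Tableaux

/-! ### Row-strict fillings as families of sets -/

section Fillings

variable {P : Type*} [CommRing P]

open Classical in
theorem sum_strictMono_eq_sum_powersetCard (x : ℕ → P) (N v b : ℕ) (h : Finset ℕ → P) :
    ∑ r ∈ univ.filter (fun r : Fin b → Fin N => StrictMono r ∧ ∀ c, v ≤ (r c : ℕ)),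
      (∏ c, x (r c)) * h (univ.image fun c => (r c : ℕ)) =
    ∑ X ∈ powersetCard b (Ico v N), (∏ i ∈ X, x i) * h X := by
  have hinj : ∀ r : Fin b → Fin N, StrictMono r → Function.Injective fun c => (r c : ℕ) :=
    fun r hr c d hcd => hr.injective (Fin.ext hcd)
  refine sum_bij (fun r _ => univ.image fun c => (r c : ℕ)) ?_ ?_ ?_ ?_
  · intro r hr
    obtain ⟨hr, hv⟩ := (mem_filter.1 hr).2
    rw [mem_powersetCard, card_image_of_injective _ (hinj r hr), card_univ, Fintype.card_fin]
    refine ⟨fun i hi => ?_, rfl⟩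
    obtain ⟨c, -, rfl⟩ := mem_image.1 hi
    exact mem_Ico.2 ⟨hv c, (r c).2⟩
  · intro r hr r' hr' hrr
    have h1 : StrictMono fun c => (r c : ℕ) := (mem_filter.1 hr).2.1
    have h2 : StrictMono fun c => (r' c : ℕ) := (mem_filter.1 hr').2.1
    have h3 : Set.range (fun c => (r c : ℕ)) = Set.range fun c => (r' c : ℕ) := by
      have := congrArg (fun X : Finset ℕ => (X : Set ℕ)) hrr
      simpa using this
    have h4 := (h1.range_inj h2).1 h3
    funext c
    exact Fin.ext (congrFun h4 c)
  · intro X hX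
    rw [mem_powersetCard] at hX
    have hmem : ∀ c, X.orderEmbOfFin hX.2 c ∈ Ico v N := fun c =>
      hX.1 (X.orderEmbOfFin_mem hX.2 c)
    refine ⟨fun c => ⟨X.orderEmbOfFin hX.2 c, (mem_Ico.1 (hmem c)).2⟩, ?_, ?_⟩
    · rw [mem_filter]
      exact ⟨mem_univ _, fun c d hcd => (X.orderEmbOfFin hX.2).strictMono hcd,
        fun c => (mem_Ico.1 (hmem c)).1⟩
    · apply coe_injective
      simp
  · intro r hr
    rw [prod_image fun c _ d _ hcd => hinj r (mem_filter.1 hr).2.1 hcd]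

/-- Row-strict fillings with entries `≥ v` of the diagram of `β`: rows increase strictly and the
leftmost column increases weakly from bottom to top. -/
def IsRowStrict {N : ℕ} (v : ℕ) (β : List ℕ) (G : ∀ i : Fin β.length, Fin (β.get i) → Fin N) :
    Prop :=
  (∀ i, StrictMono (G i)) ∧ (∀ i c, v ≤ (G i c : ℕ)) ∧
    ∀ i j, i < j → ∀ c d, c.1 = 0 → d.1 = 0 → G i c ≤ G j d

/-- Each row is bounded below by its first box, so comparing the bottom row with the others in the
leftmost column amounts to one lower bound on all entries above. -/
theorem isRowStrict_cons {N v b : ℕ} {β : List ℕ} (hb : 0 < b) (r : Fin b → Fin N)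
    (G : ∀ i : Fin β.length, Fin (β.get i) → Fin N) :
    IsRowStrict v (b :: β)
        (Fin.cons (α := fun i : Fin (β.length + 1) => Fin ((b :: β).get i) → Fin N) r G) ↔
      (StrictMono r ∧ ∀ c, v ≤ (r c : ℕ)) ∧ IsRowStrict (r ⟨0, hb⟩) β G := by
  constructor
  · rintro ⟨h1, h2, h3⟩
    refine ⟨⟨h1 0, h2 0⟩, fun i => h1 i.succ, fun i c => ?_, fun i j hij c d hc hd =>
      h3 i.succ j.succ (Fin.succ_lt_succ_iff.2 hij) c d hc hd⟩
    have hc0 : 0 < β.get i := Nat.pos_of_ne_zero fun h => by have := c.2; omega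
    have e1 : r ⟨0, hb⟩ ≤ G i ⟨0, hc0⟩ :=
      h3 0 i.succ (Fin.succ_pos i) ⟨0, hb⟩ ⟨0, hc0⟩ rfl rfl
    have e2 : G i ⟨0, hc0⟩ ≤ G i c := (h1 i.succ).monotone (Fin.mk_le_of_le_val (Nat.zero_le _))
    exact e1.trans e2
  · rintro ⟨⟨h1, h2⟩, h3, h4, h5⟩
    refine ⟨fun i => ?_, fun i => ?_, fun i j => ?_⟩
    · refine Fin.cases ?_ (fun i => ?_) i
      · exact h1
      · exact h3 i
    · refine Fin.cases ?_ (fun i => ?_) i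
      · exact h2
      · exact fun c => (h2 _).trans (h4 i c)
    · refine Fin.cases ?_ (fun i => ?_) i <;> refine Fin.cases ?_ (fun j => ?_) j
      · intro h
        exact absurd h (lt_irrefl _)
      · intro _ c d hc _
        have hc' : c = ⟨0, hb⟩ := Fin.ext hc
        subst hc'
        exact h4 j d
      · intro h
        exact absurd h (Fin.not_lt_zero _)
      · intro hij c d hc hd
        exact h5 i j (Fin.succ_lt_succ_iff.1 hij) c d hc hd

open Classical in
theorem sum_isRowStrict (x : ℕ → P) (N v : ℕ) {β : List ℕ} (hβ : ∀ b ∈ β, 0 < b) :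
    ∑ G : (∀ i : Fin β.length, Fin (β.get i) → Fin N) with IsRowStrict v β G,
      ∏ i, ∏ c, x (G i c) = rowStrictSum x N v β := by
  induction β generalizing v with
  | nil =>
    have : ∀ G : (∀ i : Fin ([] : List ℕ).length, Fin ([].get i) → Fin N),
        IsRowStrict v [] G := fun G => ⟨fun i => i.elim0, fun i => i.elim0, fun i => i.elim0⟩
    rw [filter_true_of_mem fun G _ => this G]
    have h : ∀ G : (∀ i : Fin ([] : List ℕ).length, Fin ([].get i) → Fin N),
        ∏ i, ∏ c, x (G i c) = 1 := fun G => Fin.prod_univ_zero _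
    simp only [h, rowStrictSum]
    have : Subsingleton (∀ i : Fin ([] : List ℕ).length, Fin ([].get i) → Fin N) :=
      ⟨fun a b => funext fun i => i.elim0⟩
    have : Unique (∀ i : Fin ([] : List ℕ).length, Fin ([].get i) → Fin N) :=
      ⟨⟨fun i => i.elim0⟩, fun _ => Subsingleton.elim _ _⟩
    rw [sum_const, card_univ, Fintype.card_unique, one_smul]
  | cons b β ih =>
    simp only [List.forall_mem_cons] at hβ
    have hβ1 : 0 < b := hβ.1
    rw [rowStrictSum, ← sum_strictMono_eq_sum_powersetCard x N v b
      (fun X => rowStrictSum x N (sInf (X : Set ℕ)) β), sum_filter]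
    refine (Equiv.sum_comp (Fin.consEquiv fun i : Fin (β.length + 1) =>
      Fin ((b :: β).get i) → Fin N) _).symm.trans ?_
    rw [Fintype.sum_prod_type, sum_filter]
    refine sum_congr rfl fun (r : Fin b → Fin N) _ => ?_
    have hr0 : StrictMono r → sInf ((univ.image fun c => (r c : ℕ) : Finset ℕ) : Set ℕ) =
        r ⟨0, hβ1⟩ := by
      intro hr
      apply IsLeast.csInf_eq
      simp only [coe_image, coe_univ, Set.image_univ]
      refine ⟨⟨_, rfl⟩, ?_⟩
      rintro _ ⟨c, rfl⟩
      exact hr.monotone (Fin.mk_le_of_le_val (Nat.zero_le _))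
    split_ifs with hr
    · rw [hr0 hr.1, ← ih _ hβ.2, sum_filter, mul_sum]
      refine sum_congr rfl fun G _ => ?_
      have hc := isRowStrict_cons (v := v) hβ1 r G
      rw [eq_true hr, true_and] at hc
      have hp : ∏ i : Fin (b :: β).length, ∏ c, x ((Fin.consEquiv fun i : Fin (β.length + 1) =>
          Fin ((b :: β).get i) → Fin N) (r, G) i c) =
          (∏ c, x (r c)) * ∏ i, ∏ c, x (G i c) :=
        Fin.prod_univ_succ (n := β.length) _
      by_cases hG : IsRowStrict (r ⟨0, hβ1⟩) β G
      · rw [if_pos hG]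
        exact (if_pos (hc.2 hG)).trans hp
      · rw [if_neg hG, mul_zero]
        exact if_neg fun h => hG (hc.1 h)
    · refine sum_eq_zero fun G _ => if_neg fun h => hr ?_
      exact ((isRowStrict_cons (v := v) hβ1 r G).1 h).1

end Fillings

/-! ### Standardization of row-strict fillings -/

section Standardization

theorem partialSumSet_comp {n : ℕ} (S : Finset (Fin (n - 1))) : partialSumSet (comp S) = S := by
  simp [partialSumSet, comp]

/-- Equal consecutive values are allowed exactly at descents, where the next entry lies in a
strictly higher row; thus ties are broken by the row. -/
theorem isFundamentalSeq_comp_compl_descents {n : ℕ} (α : Composition n) (T : Cell α ≃ Fin n)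
    (f : Fin n → ℕ) : IsFundamentalSeq (comp (descents α T)ᶜ) f ↔
      StrictMono fun j => toLex (f j, (T.symm j).1) := by
  rw [IsFundamentalSeq, partialSumSet_comp]
  rcases n with _ | n
  · exact ⟨fun _ j => j.elim0, fun _ => ⟨fun j => j.elim0, fun j => j.elim0⟩⟩
  · rw [Fin.strictMono_iff_lt_succ, Fin.monotone_iff_le_succ]
    change (∀ j : Fin n, f j.castSucc ≤ f j.succ) ∧
      (∀ j : Fin n, f j.castSucc = f j.succ → j ∉ (descents α T)ᶜ) ↔ _
    rw [← forall_and]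
    refine forall_congr' fun j => ?_
    rw [Prod.Lex.toLex_lt_toLex, mem_compl, not_not, descents, mem_filter]
    change f j.castSucc ≤ f j.succ ∧ (f j.castSucc = f j.succ →
      j ∈ univ ∧ (T.symm j.castSucc).1 < (T.symm j.succ).1) ↔ _
    simp only [mem_univ, true_and]
    constructor
    · rintro ⟨h1, h2⟩
      rcases h1.lt_or_eq with h | h
      · exact Or.inl h
      · exact Or.inr ⟨h, h2 h⟩
    · rintro (h | ⟨h1, h2⟩)
      · exact ⟨h.le, fun h' => absurd h' h.ne⟩
      · exact ⟨h1.le, fun _ => h2⟩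

theorem isRowStrict_of_isSIT {n N : ℕ} {α : Composition n} {T : Cell α ≃ Fin n} (hT : IsSIT α T)
    {f : Fin n → Fin N} (hf : IsFundamentalSeq (comp (descents α T)ᶜ) fun j => (f j : ℕ)) :
    IsRowStrict 0 α.blocks fun i c => f (T ⟨i, c⟩) := by
  have hs := (isFundamentalSeq_comp_compl_descents α T _).1 hf
  refine ⟨fun i c d hcd => ?_, fun i c => Nat.zero_le _, fun i j hij c d hc hd => ?_⟩
  · have := hs (hT.2 i c d hcd)
    simp only [Equiv.symm_apply_apply, Prod.Lex.toLex_lt_toLex, lt_self_iff_false, and_false,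
      or_false] at this
    exact this
  · exact hf.1 (hT.1 ⟨i, c⟩ ⟨j, d⟩ hc hd hij).le

/-- The boxes are numbered in lexicographic order of (entry, row). This separates boxes because rows
are strict, and breaking ties upwards makes the leftmost column strictly increasing. -/
theorem exists_isSIT_of_isRowStrict {n N : ℕ} {α : Composition n}
    {G : ∀ i : Fin α.blocks.length, Fin (α.blocks.get i) → Fin N}
    (hG : IsRowStrict 0 α.blocks G) :
    ∃ (T : Cell α ≃ Fin n) (f : Fin n → Fin N), IsSIT α T ∧
      IsFundamentalSeq (comp (descents α T)ᶜ) (fun j => (f j : ℕ)) ∧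
      (fun i c => f (T ⟨i, c⟩)) = G := by
  obtain ⟨h1, -, h3⟩ := hG
  let key : Cell α → ℕ ×ₗ Fin α.length := fun p => toLex ((G p.1 p.2 : ℕ), p.1)
  have hkey : Function.Injective key := by
    rintro ⟨i, c⟩ ⟨j, d⟩ h
    have h' := Prod.ext_iff.1 (toLex_inj.1 h)
    obtain rfl : i = j := h'.2
    obtain rfl : c = d := (h1 i).injective (Fin.ext h'.1)
    rfl
  have hcard : (univ.image key).card = n := by
    rw [card_image_of_injective _ hkey, card_univ, Fintype.card_sigma]
    simp [α.sum_blocksFun]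
  let E : Fin n ≃o univ.image key := (univ.image key).orderIsoOfFin hcard
  let K : Cell α ≃ univ.image key := Equiv.ofBijective
    (fun p => ⟨key p, mem_image_of_mem _ (mem_univ _)⟩) ⟨fun p q h => hkey (congrArg Subtype.val h),
      fun ⟨y, hy⟩ => by
        obtain ⟨p, -, hp⟩ := mem_image.1 hy
        exact ⟨p, Subtype.ext hp⟩⟩
  have hK : ∀ y, key (K.symm y) = y := fun y => congrArg Subtype.val (K.apply_symm_apply y)
  have hE : ∀ p q, key p < key q → E.symm (K p) < E.symm (K q) := fun p q h =>
    E.symm.strictMono (show K p < K q from h)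
  refine ⟨K.trans E.symm.toEquiv, fun j => G (K.symm (E j)).1 (K.symm (E j)).2, ⟨?_, ?_⟩, ?_, ?_⟩
  · intro p q hp hq hpq
    apply hE
    rw [Prod.Lex.toLex_lt_toLex]
    rcases (h3 p.1 q.1 hpq p.2 q.2 hp hq).lt_or_eq with h | h
    · exact Or.inl h
    · exact Or.inr ⟨congrArg Fin.val h, hpq⟩
  · intro i c d hcd
    apply hE
    rw [Prod.Lex.toLex_lt_toLex]
    exact Or.inl (h1 i hcd)
  · rw [isFundamentalSeq_comp_compl_descents]
    intro a b hab
    change key (K.symm (E a)) < key (K.symm (E b))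
    rw [hK, hK]
    exact E.strictMono hab
  · funext i c
    have : K.symm (E (E.symm (K ⟨i, c⟩))) = ⟨i, c⟩ := by
      rw [E.apply_symm_apply, K.symm_apply_apply]
    change G (K.symm (E (E.symm (K ⟨i, c⟩)))).1 (K.symm (E (E.symm (K ⟨i, c⟩)))).2 = G i c
    rw [this]

/-- A strictly increasing sequence is determined by its range. Here the range is the set of pairs
(entry, row) of the common filling. -/
theorem standardization_unique {n N : ℕ} {α : Composition n} {T T' : Cell α ≃ Fin n}
    {f f' : Fin n → Fin N}
    (hf : IsFundamentalSeq (comp (descents α T)ᶜ) fun j => (f j : ℕ))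
    (hf' : IsFundamentalSeq (comp (descents α T')ᶜ) fun j => (f' j : ℕ))
    (h : ∀ p, f (T p) = f' (T' p)) : T = T' ∧ f = f' := by
  rw [isFundamentalSeq_comp_compl_descents] at hf hf'
  have hrange : Set.range (fun j => toLex ((f j : ℕ), (T.symm j).1)) =
      Set.range fun j => toLex ((f' j : ℕ), (T'.symm j).1) := by
    ext y
    constructor
    · rintro ⟨j, rfl⟩
      refine ⟨T' (T.symm j), ?_⟩
      simp [← h]
    · rintro ⟨j, rfl⟩
      refine ⟨T (T'.symm j), ?_⟩
      simp [h]
  have heq := (hf.range_inj hf').1 hrange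
  have hff : f = f' := by
    funext j
    exact Fin.ext (congrArg (fun y => (ofLex y).1) (congrFun heq j))
  refine ⟨?_, hff⟩
  subst hff
  have hsymm : T.symm = T'.symm := by
    ext1 j
    have hj : f (T (T'.symm j)) = f j := by rw [h, Equiv.apply_symm_apply]
    have hrow : (T.symm j).1 = (T'.symm j).1 :=
      congrArg (fun y => (ofLex y).2) (congrFun heq j)
    have : T (T'.symm j) = j := by
      apply hf.injective
      simp only [Equiv.symm_apply_apply, hj, hrow]
    rw [Equiv.symm_apply_eq, this]
  rw [← T.symm_symm, hsymm, T'.symm_symm]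

open Classical in
theorem sum_isSIT_sum_isFundamentalSeq {P : Type*} [CommRing P] (x : ℕ → P) (N : ℕ) {n : ℕ}
    (α : Composition n) :
    ∑ T : Cell α ≃ Fin n with IsSIT α T, ∑ f : Fin n → Fin N
        with IsFundamentalSeq (comp (descents α T)ᶜ) (fun j => (f j : ℕ)), ∏ j, x (f j) =
      rowStrictSum x N 0 α.blocks := by
  rw [← sum_isRowStrict x N 0 (fun b hb => α.blocks_pos hb), sum_sigma']
  refine sum_bij (fun y _ i c => y.2 (y.1 ⟨i, c⟩)) ?_ ?_ ?_ ?_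
  · rintro ⟨T, f⟩ h
    simp only [mem_sigma, mem_filter, mem_univ, true_and] at h ⊢
    exact isRowStrict_of_isSIT h.1 h.2
  · rintro ⟨T, f⟩ h ⟨T', f'⟩ h' hG
    simp only [mem_sigma, mem_filter, mem_univ, true_and] at h h'
    obtain ⟨rfl, rfl⟩ := standardization_unique h.2 h'.2
      fun p => congrFun (congrFun hG p.1) p.2
    rfl
  · intro G hG
    obtain ⟨T, f, hT, hf, h⟩ := exists_isSIT_of_isRowStrict (mem_filter.1 hG).2
    refine ⟨⟨T, f⟩, ?_, h⟩
    simp only [mem_sigma, mem_filter, mem_univ, true_and]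
    exact ⟨hT, hf⟩
  · rintro ⟨T, f⟩ -
    change ∏ j, x (f j) = ∏ i : Fin α.length, ∏ c : Fin (α.blocksFun i), x (f (T ⟨i, c⟩))
    rw [← Equiv.prod_comp T, Fintype.prod_sigma]

end Standardization

/-! ### Coefficients of the Pieri recursion -/

section Coefficients

/-- The coefficient of the shape `β` in the Pieri rule for the shape `γ`, by recursion on the
rows. -/
def pieriRec : ℕ → List ℕ → List ℕ → ℤ
  | s, [], β => if β = (if s = 0 then [] else [s]) then 1 else 0
  | _, _ :: _, [] => 0
  | s, g :: γ, b :: β => (if s ≠ 0 ∧ b = s ∧ β = g :: γ then 1 else 0) +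
      if b ≤ s + g then pieriSign s b g * pieriRec (s + g - b) γ β else 0

theorem pieriRec_nil (s : ℕ) (β : List ℕ) :
    pieriRec s [] β = if β = (if s = 0 then [] else [s]) then 1 else 0 := by
  cases β <;> rfl

theorem pieriRec_cons_nil (s g : ℕ) (γ : List ℕ) : pieriRec s (g :: γ) [] = 0 := rfl

theorem pieriRec_cons_cons (s g b : ℕ) (γ β : List ℕ) : pieriRec s (g :: γ) (b :: β) =
    (if s ≠ 0 ∧ b = s ∧ β = g :: γ then 1 else 0) +
      if b ≤ s + g then pieriSign s b g * pieriRec (s + g - b) γ β else 0 := rfl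

theorem skew_single {P : Type*} [CommRing P] (s : ℕ) (γ : List ℕ) {β : List ℕ}
    (hβ : ∀ b ∈ β, 0 < b) :
    skew P s γ (Pi.single β 1) = (pieriRec s γ β : P) := by
  induction γ generalizing s β with
  | nil =>
    rw [skew_nil, pieriRec_nil]
    split_ifs with h1 h2 h2 <;> simp [Pi.single_apply, eq_comm] at h2 ⊢ <;> tauto
  | cons g γ ih =>
    rw [skew_cons]
    rcases β with _ | ⟨b, β⟩
    · rw [pieriRec_cons_nil, Int.cast_zero, sum_eq_zero, add_zero]
      · simp
      · intro i _
        have : (fun l => (Pi.single [] 1 : List ℕ → P) ((i + 1) :: l)) = 0 :=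
          funext fun l => by simp
        rw [this, map_zero, smul_zero]
    · simp only [List.forall_mem_cons] at hβ
      obtain ⟨b, rfl⟩ : ∃ c, b = c + 1 := ⟨b - 1, by omega⟩
      have h1 : ∀ i, (fun l => (Pi.single ((b + 1) :: β) 1 : List ℕ → P) ((i + 1) :: l)) =
          if i = b then Pi.single β 1 else 0 := by
        intro i
        funext l
        by_cases hi : i = b
        · subst hi
          simp [Pi.single_apply]
        · simp [hi]
      rw [pieriRec_cons_cons, Int.cast_add]
      congr 1
      · by_cases hs : s = 0
        · simp [hs]
        · simp [hs, Pi.single_apply, eq_comm]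
      · simp only [h1]
        split_ifs with hb
        · rw [sum_eq_single_of_mem b (mem_range.2 hb) fun i _ hi => by
            rw [if_neg hi, map_zero, smul_zero], if_pos rfl, ih _ hβ.2, zsmul_eq_mul,
            Int.cast_mul]
        · rw [Int.cast_zero]
          refine sum_eq_zero fun i hi => ?_
          rw [mem_range] at hi
          rw [if_neg (by omega), map_zero, smul_zero]

/-- By `skew_congr` only lists of positive parts with sum n + s matter, so `F` may be replaced by a
finite combination of indicators of compositions. -/
theorem skew_blocks {P : Type*} [CommRing P] {n : ℕ} (s : ℕ) (α : Composition n)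
    (F : List ℕ → P) : skew P s α.blocks F =
      ∑ β : Composition (n + s), pieriRec s α.blocks β.blocks • F β.blocks := by
  have h : skew P s α.blocks F =
      skew P s α.blocks (∑ β : Composition (n + s), F β.blocks • Pi.single β.blocks 1) := by
    refine skew_congr s (fun b hb => α.blocks_pos hb) fun l hl hsum => ?_
    rw [α.blocks_sum] at hsum
    rw [Finset.sum_apply, sum_eq_single_of_mem ⟨l, fun {i} hi => hl i hi, hsum⟩ (mem_univ _)]
    · simp
    · intro β _ hβ
      have : l ≠ β.blocks := fun h => hβ (Composition.ext h.symm)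
      simp [this]
  rw [h, map_sum]
  refine sum_congr rfl fun β _ => ?_
  rw [map_smul, skew_single s _ fun b hb => β.blocks_pos hb, smul_eq_mul, zsmul_eq_mul, mul_comm]

end Coefficients

/-! ### Passage from finitely many variables to power series -/

section Series

variable (R : Type*) [CommRing R]

theorem prod_X_eq_monomial {n : ℕ} (f : Fin n → ℕ) :
    ∏ j, (MvPowerSeries.X (f j) : MvPowerSeries ℕ R) =
      MvPowerSeries.monomial (∑ j, Finsupp.single (f j) 1) 1 := by
  induction n with
  | zero => simp
  | succ n ih =>
    rw [Fin.prod_univ_succ, Fin.sum_univ_succ, ih, MvPowerSeries.X,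
      MvPowerSeries.monomial_mul_monomial, one_mul]

open Classical in
-- A sequence with monomial `m` takes values in the support of `m`, so truncating to values below
-- `N` loses nothing.
theorem coeff_fundamental {n N : ℕ} (α : Composition n) (m : ℕ →₀ ℕ)
    (hm : ∀ i ∈ m.support, i < N) :
    MvPowerSeries.coeff m (fundamental R α) = MvPowerSeries.coeff m
      (∑ f : Fin n → Fin N with IsFundamentalSeq α (fun j => (f j : ℕ)),
        ∏ j, (MvPowerSeries.X (f j : ℕ) : MvPowerSeries ℕ R)) := by
  have h1 : MvPowerSeries.coeff m (fundamental R α) = (Nat.card {f : Fin n → ℕ //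
    IsFundamentalSeq α f ∧ ∑ j, Finsupp.single (f j) 1 = m} : R) := rfl
  have hlt : ∀ f : Fin n → ℕ, ∑ j, Finsupp.single (f j) 1 = m → ∀ j, f j < N := by
    rintro f rfl j
    apply hm
    rw [Finsupp.mem_support_iff, Finsupp.finsetSum_apply]
    refine (Finset.sum_pos' (fun _ _ => Nat.zero_le _) ⟨j, mem_univ j, ?_⟩).ne'
    simp
  have h2 : {f : Fin n → ℕ // IsFundamentalSeq α f ∧ ∑ j, Finsupp.single (f j) 1 = m} ≃
      {f : Fin n → Fin N // IsFundamentalSeq α (fun j => (f j : ℕ)) ∧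
        ∑ j, Finsupp.single (f j : ℕ) 1 = m} :=
    { toFun := fun f => ⟨fun j => ⟨f.1 j, hlt f.1 f.2.2 j⟩, f.2⟩
      invFun := fun f => ⟨fun j => (f.1 j : ℕ), f.2⟩
      left_inv := fun _ => rfl
      right_inv := fun _ => rfl }
  rw [h1, Nat.card_congr h2, Nat.card_eq_fintype_card, Fintype.card_subtype, map_sum,
    ← filter_filter, card_filter, Nat.cast_sum]
  refine sum_congr rfl fun f _ => ?_
  rw [prod_X_eq_monomial, MvPowerSeries.coeff_monomial]
  by_cases h : ∑ j, Finsupp.single (f j : ℕ) 1 = m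
  · simp [h]
  · rw [if_neg h, if_neg (Ne.symm h), Nat.cast_zero]

theorem isFundamentalSeq_ones {s : ℕ} (f : Fin s → ℕ) :
    IsFundamentalSeq (Composition.ones s) f ↔ StrictMono f := by
  have hset : ∀ j : Fin (s - 1), j ∈ partialSumSet (Composition.ones s) := by
    intro j
    have hj := j.2
    have : (⟨1 + j.1, by omega⟩ : Fin s.succ) ∈ (Composition.ones s).boundaries :=
      mem_map.2 ⟨⟨1 + j.1, by rw [Composition.ones_length]; omega⟩, mem_univ _, Fin.ext (by
        simp [Composition.boundary]; omega)⟩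
    exact Set.mem_toFinset.2 this
  rcases s with _ | s
  · exact ⟨fun _ j => j.elim0, fun _ => ⟨fun j => j.elim0, fun j => j.elim0⟩⟩
  · rw [IsFundamentalSeq, Fin.strictMono_iff_lt_succ, Fin.monotone_iff_le_succ]
    change (∀ j : Fin s, f j.castSucc ≤ f j.succ) ∧
      (∀ j : Fin s, f j.castSucc = f j.succ → j ∉ partialSumSet (Composition.ones (s + 1))) ↔ _
    rw [← forall_and]
    exact forall_congr' fun j => ⟨fun h => h.1.lt_of_ne fun h' => h.2 h' (hset j),
      fun h => ⟨h.le, fun h' => absurd h' h.ne⟩⟩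

theorem coeff_rowStrictDualImmaculate {n N : ℕ} (α : Composition n) (m : ℕ →₀ ℕ)
    (hm : ∀ i ∈ m.support, i < N) :
    MvPowerSeries.coeff m (rowStrictDualImmaculate R α) =
      MvPowerSeries.coeff m (rowStrictSum MvPowerSeries.X N 0 α.blocks : MvPowerSeries ℕ R) := by
  rw [← sum_isSIT_sum_isFundamentalSeq, rowStrictDualImmaculate, map_sum, map_sum]
  refine sum_congr ?_ fun T _ => coeff_fundamental R _ m hm
  ext T
  simp

theorem coeff_fundamental_ones {s N : ℕ} (m : ℕ →₀ ℕ) (hm : ∀ i ∈ m.support, i < N) :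
    MvPowerSeries.coeff m (fundamental R (Composition.ones s)) =
      MvPowerSeries.coeff m (elemSymm MvPowerSeries.X s N : MvPowerSeries ℕ R) := by
  classical
  have h := sum_strictMono_eq_sum_powersetCard (MvPowerSeries.X : ℕ → MvPowerSeries ℕ R) N 0 s
    fun _ => 1
  simp only [mul_one] at h
  rw [coeff_fundamental R _ m hm, elemSymm, ← h]
  congr 1
  refine sum_congr ?_ fun _ _ => rfl
  ext f
  simp only [mem_filter, mem_univ, true_and, isFundamentalSeq_ones, Nat.zero_le, implies_true,
    and_true]
  rfl

theorem fundamental_ones_mul_rowStrictDualImmaculate {n : ℕ} (s : ℕ) (α : Composition n) :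
    fundamental R (Composition.ones s) * rowStrictDualImmaculate R α =
      ∑ β : Composition (n + s),
        pieriRec s α.blocks β.blocks • rowStrictDualImmaculate R β := by
  ext m
  -- One `N` beyond the support of `m` serves for all divisors of `m`, hence for every term of the
  -- product's coefficient.
  obtain ⟨N, hN⟩ : ∃ N, ∀ i ∈ m.support, i < N :=
    ⟨m.support.sup id + 1, fun i hi => Nat.lt_succ_of_le (le_sup (f := id) hi)⟩
  have hle : ∀ p ≤ m, ∀ i ∈ p.support, i < N := fun p hp i hi =>
    hN i (Finsupp.support_mono hp hi)
  have h := congrArg (MvPowerSeries.coeff m) (elemSymm_mul_rowStrictSum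
    (MvPowerSeries.X : ℕ → MvPowerSeries ℕ R) s N fun b hb => α.blocks_pos hb)
  rw [skew_blocks, map_sum, MvPowerSeries.coeff_mul] at h
  rw [map_sum, MvPowerSeries.coeff_mul]
  refine Eq.trans ?_ (h.trans ?_)
  · refine sum_congr rfl fun p hp => ?_
    rw [HasAntidiagonal.mem_antidiagonal] at hp
    rw [coeff_fundamental_ones R p.1 (hle _ (hp ▸ self_le_add_right _ _)),
      coeff_rowStrictDualImmaculate R α p.2 (hle _ (hp ▸ self_le_add_left _ _))]
  · refine sum_congr rfl fun β _ => ?_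
    rw [map_zsmul, map_zsmul, coeff_rowStrictDualImmaculate R β m hN]

end Series

/-! ### Solution of the recursion: the set `Z` and the parity condition -/

section PieriCoefficient

/-- The entry of `l` at position `i` as an integer, `0` beyond the end. -/
def entry (l : List ℕ) (i : ℕ) : ℤ := (l.getD i 0 : ℕ)

theorem entry_cons_succ (a : ℕ) (l : List ℕ) (i : ℕ) : entry (a :: l) (i + 1) = entry l i := by
  simp [entry]

theorem entry_pos {l : List ℕ} (hl : ∀ b ∈ l, 0 < b) {i : ℕ} (hi : i < l.length) :
    0 < entry l i := by
  rw [entry, List.getD_eq_getElem _ _ hi]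
  exact_mod_cast hl _ (List.getElem_mem hi)

theorem entry_drop (l : List ℕ) (i j : ℕ) : entry (l.drop j) i = entry l (j + i) := by
  simp [entry, List.getD_eq_getElem?_getD, List.getElem?_drop]

theorem sum_Iic_succ {k : ℕ} (β : Fin (k + 1) → ℤ) (i : Fin k) :
    ∑ l ∈ Iic i.succ, β l = β 0 + ∑ l ∈ Iic i, β l.succ := by
  have h1 : Iic i.succ = univ.filter fun l => l ≤ i.succ := by ext; simp
  have h2 : Iic i = univ.filter fun l => l ≤ i := by ext; simp
  rw [h1, h2, sum_filter, sum_filter, Fin.sum_univ_succ]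
  simp

theorem sum_Iio_succ {k : ℕ} (β : Fin (k + 1) → ℤ) (i : Fin k) :
    ∑ l ∈ Iio i.succ, β l = β 0 + ∑ l ∈ Iio i, β l.succ := by
  have h1 : Iio i.succ = univ.filter fun l => l < i.succ := by ext; simp
  have h2 : Iio i = univ.filter fun l => l < i := by ext; simp
  rw [h1, h2, sum_filter, sum_filter, Fin.sum_univ_succ]
  simp

theorem sum_Iio_zero {k : ℕ} (β : Fin (k + 1) → ℤ) : ∑ l ∈ Iio (0 : Fin (k + 1)), β l = 0 := by
  have : Iio (0 : Fin (k + 1)) = ∅ := by ext; simp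
  rw [this, sum_empty]

theorem sum_Iic_zero {k : ℕ} (β : Fin (k + 1) → ℤ) : ∑ l ∈ Iic (0 : Fin (k + 1)), β l = β 0 := by
  have : Iic (0 : Fin (k + 1)) = {0} := by ext; simp
  rw [this, sum_singleton]

theorem apply_zero_le_of_mem_Z {s k : ℕ} {α β : Fin (k + 1) → ℤ} (h : β ∈ Z s α) : β 0 ≤ s := by
  obtain ⟨⟨hsum, hp⟩, -⟩ := h
  rcases k with _ | k
  · simpa using hsum.le
  · simpa only [sum_Iic_zero] using hp 0 (by simp)

/-- For the tail, t_2 = s - β_1 = s + g - b takes the role of s. As g > 0, the exceptional case β_1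
= α_1 is excluded and the first row does not count as a zero of α - β; its remaining conditions say
that the sign is nonzero and b ≤ s + g. -/
theorem mem_Z_succ {s k b g : ℕ} (hg : 0 < g) (α β : Fin (k + 1) → ℤ) (hα : α 0 = b)
    (hβ : β 0 = b - g) : β ∈ Z s α ↔ (b ≤ s + g ∧ pieriSign s b g ≠ 0) ∧
      (fun i : Fin k => β i.succ) ∈ Z (s + g - b) fun i => α i.succ := by
  have hsign : pieriSign s b g ≠ 0 ↔ (s < b ∧ g ≤ b) ∨ (b ≤ s ∧ b < g) := by
    rw [pieriSign]
    split_ifs <;> simp <;> omega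
  have hcard : (univ.filter fun i => α i - β i = 0).card =
      (univ.filter fun i : Fin k => α i.succ - β i.succ = 0).card := by
    rw [card_filter, card_filter, Fin.sum_univ_succ, if_neg (by rw [hα, hβ]; omega), zero_add]
  by_cases hle : b ≤ s + g
  · have hcast : ((s + g - b : ℕ) : ℤ) = s - β 0 := by rw [hβ]; omega
    rw [hsign]
    constructor
    · rintro ⟨⟨hs, hp⟩, ⟨hn, hc⟩, hl⟩
      refine ⟨⟨hle, ?_⟩, ⟨?_, fun i hi => ?_⟩, ⟨fun i => hn i.succ, hcard ▸ hc⟩, fun i => ?_⟩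
      · obtain ⟨h1, h2, h3⟩ := hl 0
        rw [sum_Iio_zero, hα, hβ] at h1 h2 h3
        by_cases h4 : s < b
        · have := h1 (by omega)
          omega
        · by_cases h5 : b < s
          · have := h2 (by omega)
            omega
          · rcases h3 (by omega) with h6 | h6
            · omega
            · have := h6.1
              omega
      · rw [Fin.sum_univ_succ] at hs
        rw [hcast]
        linarith
      · have := hp i.succ (by simpa using hi)
        rw [sum_Iic_succ] at this
        rw [hcast]
        linarith
      · have := hl i.succ
        rw [sum_Iio_succ, ← sub_sub, ← hcast] at this
        exact ⟨this.1, this.2.1, fun h => (this.2.2 h).imp id fun h' =>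
          ⟨h'.1, fun l hl => h'.2 l.succ (Fin.succ_lt_succ_iff.2 hl)⟩⟩
    · rintro ⟨⟨-, h⟩, ⟨hs, hp⟩, ⟨hn, hc⟩, hl⟩
      rw [hcast] at hs
      simp only [hcast] at hp hl
      refine ⟨⟨?_, fun i => ?_⟩, ⟨fun i => ?_, hcard ▸ hc⟩, fun i => ?_⟩
      · rw [Fin.sum_univ_succ, hs]
        ring
      · refine Fin.cases (fun _ => ?_) (fun i hi => ?_) i
        · rw [sum_Iic_zero, hβ]
          omega
        · have := hp i (by simpa using hi)
          rw [sum_Iic_succ]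
          linarith
      · refine Fin.cases ?_ (fun i => hn i) i
        rw [hα, hβ]
        omega
      · refine Fin.cases ?_ (fun i => ?_) i
        · rw [sum_Iio_zero, hα, hβ]
          refine ⟨fun _ => ?_, fun _ => ?_, fun _ => Or.inl ?_⟩ <;> omega
        · have := hl i
          rw [sum_Iio_succ, ← sub_sub]
          refine ⟨this.1, this.2.1, fun h => (this.2.2 h).imp id fun h' => ⟨h'.1, fun l => ?_⟩⟩
          refine Fin.cases (fun h => absurd h (Fin.not_lt_zero _)) (fun l hl => ?_) l
          exact h'.2 l (Fin.succ_lt_succ_iff.1 hl)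
  · refine ⟨fun h => ?_, fun h => absurd h.1.1 hle⟩
    have := apply_zero_le_of_mem_Z h
    rw [hβ] at this
    omega

/-- This is the case g = 0 left out of `mem_Z_succ`, in which a whole row is new. After it t_i = 0,
which the zero entries satisfy because the parts of α are positive. -/
theorem mem_Z_of_succ_eq_zero {s k : ℕ} (α β : Fin (k + 1) → ℤ) (hα : ∀ i, 0 < α i)
    (h0 : β 0 = α 0) (hβ : ∀ i : Fin k, β i.succ = 0) : β ∈ Z s α ↔ α 0 = s := by
  have hsum : ∑ i, β i = α 0 := by simp [Fin.sum_univ_succ, h0, hβ]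
  have hIic : ∀ i : Fin (k + 1), ∑ l ∈ Iic i, β l = α 0 := by
    intro i
    refine Fin.cases ?_ (fun i => ?_) i
    · rw [sum_Iic_zero, h0]
    · simp [sum_Iic_succ, h0, hβ]
  refine ⟨fun h => hsum ▸ h.1.1, fun h => ⟨⟨hsum.trans h, fun i _ => (hIic i).trans_le h.le⟩,
    ⟨fun i => ?_, ?_⟩, fun i => ?_⟩⟩
  · refine Fin.cases ?_ (fun i => ?_) i
    · simp [h0]
    · rw [hβ, sub_zero]
      exact (hα _).le
  · rw [card_filter, Fin.sum_univ_succ, sum_eq_zero, add_zero]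
    · split_ifs <;> simp
    · intro i _
      rw [hβ, sub_zero, if_neg (hα _).ne']
  · refine Fin.cases ?_ (fun i => ?_) i
    · rw [sum_Iio_zero, h, h0, h]
      refine ⟨fun h' => absurd h' (by simp), fun h' => absurd h' (by simp), fun _ => Or.inr
        ⟨rfl, fun l => ?_⟩⟩
      exact Fin.cases (fun h' => absurd h' (lt_irrefl _)) (fun l _ => hβ l) l
    · have := hα i.succ
      have e : ∑ l ∈ Iio i.succ, β l = s := by simp [sum_Iio_succ, h0, hβ, h]
      rw [e, hβ, sub_self]
      refine ⟨fun _ => ⟨le_rfl, le_rfl⟩, fun h' => ?_, fun h' => ?_⟩ <;> omega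

theorem sgn_succ {k : ℕ} (β : Fin (k + 1) → ℤ) :
    sgn β = (if β 0 < 0 then -1 else 1) * sgn fun i : Fin k => β i.succ := by
  rw [sgn, sgn, card_filter, card_filter, Fin.sum_univ_succ, pow_add]
  split_ifs <;> simp

theorem pieriSign_mul_sgn {s k b g : ℕ} (β : Fin (k + 1) → ℤ) (hβ : β 0 = b - g)
    (h : pieriSign s b g ≠ 0) :
    pieriSign s b g * sgn (fun i : Fin k => β i.succ) = sgn β := by
  rw [sgn_succ, hβ]
  congr 1
  rw [pieriSign] at h ⊢
  split_ifs at h ⊢ <;> simp at h ⊢ <;> omega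

open Classical in
-- Equal lengths rule out an insertion at every level, so the coefficient is a product of signs,
-- nonzero exactly on `Z`.
theorem pieriRec_of_length_eq (s : ℕ) {γ β : List ℕ} (hγ : ∀ b ∈ γ, 0 < b)
    (h : γ.length = β.length) : pieriRec s γ β =
      if (fun i : Fin β.length => entry β i - entry γ i) ∈ Z s (fun i : Fin β.length => entry β i)
      then sgn (fun i : Fin β.length => entry β i - entry γ i) else 0 := by
  induction γ generalizing s β with
  | nil =>
    obtain rfl := List.length_eq_zero_iff.1 h.symm
    have hs : sgn (fun i : Fin ([] : List ℕ).length => entry [] i - entry [] i) = 1 := rfl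
    rw [hs, pieriRec_nil]
    congr 1
    apply propext
    rw [Z, Set.mem_ofPred_eq]
    have h1 : ∑ i : Fin ([] : List ℕ).length, (entry [] i - entry [] i) = 0 := rfl
    have h2 : (univ.filter fun i : Fin ([] : List ℕ).length =>
      entry [] i - (entry [] i - entry [] i) = 0).card = 0 := rfl
    rw [h1, h2]
    constructor
    · intro h
      have : s = 0 := by by_contra hs; simp [hs] at h
      exact ⟨⟨by simp [this], fun i => i.elim0⟩, ⟨fun i => i.elim0, by simp⟩, fun i => i.elim0⟩
    · rintro ⟨⟨h, -⟩, -⟩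
      have : s = 0 := by omega
      simp [this]
  | cons g γ ih =>
    rcases β with _ | ⟨b, β⟩
    · simp at h
    · simp only [List.forall_mem_cons] at hγ
      have hlen : γ.length = β.length := by simpa using h
      have hne : ¬ (s ≠ 0 ∧ b = s ∧ β = g :: γ) := by
        rintro ⟨-, -, rfl⟩
        simp at hlen
      have hmem := mem_Z_succ (s := s) (k := β.length) (b := b) hγ.1
        (fun i => entry (b :: β) i) (fun i => entry (b :: β) i - entry (g :: γ) i) rfl rfl
      have hsgn := pieriSign_mul_sgn (s := s) (k := β.length) (b := b) (g := g)
        (fun i => entry (b :: β) i - entry (g :: γ) i) rfl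
      simp only [Fin.val_succ, entry_cons_succ] at hmem hsgn
      rw [pieriRec_cons_cons, if_neg hne, zero_add]
      refine Eq.trans ?_ (if_congr hmem.symm rfl rfl)
      rw [ih _ hγ.2 hlen]
      by_cases h1 : b ≤ s + g
      · rw [if_pos h1]
        by_cases h2 : pieriSign s b g = 0
        · simp [h2]
        · rw [mul_ite, mul_zero, hsgn h2]
          simp [h1, h2]
      · simp [h1]

theorem pieriRec_eq_zero (s : ℕ) {γ β : List ℕ} (h : γ.length ≠ β.length)
    (h' : γ.length + 1 ≠ β.length) : pieriRec s γ β = 0 := by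
  induction γ generalizing s β with
  | nil =>
    rw [pieriRec_nil, if_neg]
    rintro rfl
    split_ifs at h h' <;> simp at h h'
  | cons g γ ih =>
    rcases β with _ | ⟨b, β⟩
    · rfl
    · rw [pieriRec_cons_cons, if_neg, zero_add, ih _ (by simpa using h) (by simpa using h'),
        mul_zero, ite_self]
      rintro ⟨-, -, rfl⟩
      simp at h'

/-- The number of steps in the longest strictly increasing run at the start of a list. -/
def ascents : List ℕ → ℕ
  | [] => 0
  | [_] => 0
  | a :: b :: l => if a < b then ascents (b :: l) + 1 else 0

theorem ascents_lt {l : List ℕ} (hl : l ≠ []) : ascents l < l.length := by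
  induction l with
  | nil => exact absurd rfl hl
  | cons a l ih =>
    rcases l with _ | ⟨b, l⟩
    · simp [ascents]
    · have := ih (by simp)
      rw [ascents]
      split_ifs <;> simp at this ⊢; omega

theorem entry_lt_of_lt_ascents {l : List ℕ} {i : ℕ} (hi : i < ascents l) :
    entry l i < entry l (i + 1) := by
  induction l generalizing i with
  | nil => simp [ascents] at hi
  | cons a l ih =>
    rcases l with _ | ⟨b, l⟩
    · simp [ascents] at hi
    · rw [ascents] at hi
      split_ifs at hi with h
      · rcases i with _ | i
        · simpa [entry] using h
        · rw [entry_cons_succ, entry_cons_succ]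
          exact ih (by omega)
      · omega

theorem not_entry_ascents_lt {l : List ℕ} (h : ascents l + 1 < l.length) :
    ¬ entry l (ascents l) < entry l (ascents l + 1) := by
  induction l with
  | nil => simp at h
  | cons a l ih =>
    rcases l with _ | ⟨b, l⟩
    · simp [ascents] at h
    · rw [ascents] at h ⊢
      split_ifs at h ⊢ with hab
      · rw [entry_cons_succ, entry_cons_succ]
        exact ih (by simpa using h)
      · simpa [entry] using hab

/-- If a = s, inserting at once gives 1. Going on to the next row b costs the sign -[a<b] and passes
on s + b - a = b, which is the same problem one row higher. The alternating sum runs along the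
initial increasing run. If a ≠ s, the mismatch persists and everything vanishes. -/
theorem pieriRec_tail (s a : ℕ) {l : List ℕ} (h : ∀ b ∈ a :: l, 0 < b) :
    pieriRec s l (a :: l) = if a = s ∧ Even (ascents (a :: l)) then 1 else 0 := by
  induction l generalizing s a with
  | nil =>
    have ha : 0 < a := h a (by simp)
    rw [pieriRec_nil, ascents]
    by_cases hs : s = 0
    · simp [hs]
      omega
    · simp [hs]
  | cons b l ih =>
    have ha : 0 < a := h a (by simp)
    rw [pieriRec_cons_cons, ih _ _ fun c hc => h c (List.mem_cons_of_mem _ hc), ascents]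
    by_cases has : a = s
    · subst has
      have h1 : a ≤ a + b := by omega
      have h2 : b = a + b - a := by omega
      rw [if_pos ⟨by omega, rfl, rfl⟩, if_pos h1, ← h2, pieriSign]
      by_cases hab : a < b
      · by_cases he : Even (ascents (b :: l))
        · simp [hab, he, Nat.even_add_one]
        · simp [hab, he, Nat.even_add_one]
      · simp [hab]
    · simp only [has, false_and, and_false, if_false, zero_add]
      by_cases h1 : a ≤ s + b
      · have h2 : b ≠ s + b - a := by omega
        simp [h2]
      · simp [h1]

open Classical in
theorem pieriRec_of_tail (s : ℕ) {a : ℕ} {l : List ℕ} (h : ∀ b ∈ a :: l, 0 < b) :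
    pieriRec s l (a :: l) =
      if Even (ascents ((a :: l).drop 0)) ∧ (fun i : Fin (a :: l).length =>
        if i.1 < 0 then entry (a :: l) i - entry l i else if i.1 = 0 then entry (a :: l) i else 0) ∈
        Z s (fun i : Fin (a :: l).length => entry (a :: l) i)
      then sgn (fun i : Fin 0 => entry (a :: l) i - entry l i) else 0 := by
  have hZ := mem_Z_of_succ_eq_zero (s := s) (k := l.length) (fun i => entry (a :: l) i)
    (fun i => if i.1 < 0 then entry (a :: l) i - entry l i
      else if i.1 = 0 then entry (a :: l) i else 0)
    (fun i => entry_pos h i.2) rfl (fun i => by simp)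
  have h0 : ((a : ℕ) : ℤ) = s ↔ a = s := Nat.cast_inj
  rw [pieriRec_tail s a h]
  refine if_congr ?_ rfl rfl
  rw [and_comm, List.drop_zero]
  exact and_congr Iff.rfl (hZ.trans h0).symm

open Classical in
-- Minimality of j forbids an insertion before row j, so up to there the signs accumulate as for
-- equal lengths. From row j on, β is the rest of γ with one row added below it, and `pieriRec_tail`
-- applies.
theorem pieriRec_of_length_succ (s : ℕ) {γ β : List ℕ} (hγ : ∀ b ∈ γ, 0 < b)
    (hβ : ∀ b ∈ β, 0 < b) (h : γ.length + 1 = β.length) {j : ℕ}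
    (hj : ∀ i < β.length, j < i → entry β i = entry γ (i - 1))
    (hmin : ∀ k < j, ¬ ∀ i < β.length, k < i → entry β i = entry γ (i - 1)) :
    pieriRec s γ β =
      if Even (ascents (β.drop j)) ∧ (fun i : Fin β.length =>
        if i.1 < j then entry β i - entry γ i else if i.1 = j then entry β i else 0) ∈
        Z s (fun i : Fin β.length => entry β i)
      then sgn (fun i : Fin j => entry β i - entry γ i) else 0 := by
  induction γ generalizing s β j with
  | nil =>
    obtain ⟨b, rfl⟩ := List.length_eq_one_iff.1 h.symm
    obtain rfl : j = 0 := by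
      by_contra hj0
      refine hmin 0 (Nat.pos_of_ne_zero hj0) fun i hi hi0 => ?_
      simp at hi
      omega
    exact pieriRec_of_tail s hβ
  | cons g γ ih =>
    rcases β with _ | ⟨b, β⟩
    · simp at h
    have hlen : γ.length + 1 = β.length := by simpa using h
    rcases j with _ | j
    · have : β = g :: γ := by
        refine List.ext_getElem (by simpa using hlen.symm) fun i h1 h2 => ?_
        have := hj (i + 1) (by simpa using h1) (Nat.succ_pos i)
        rw [entry_cons_succ, Nat.add_sub_cancel, entry, entry, List.getD_eq_getElem _ _ h1,
          List.getD_eq_getElem _ _ h2] at this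
        exact_mod_cast this
      subst this
      exact pieriRec_of_tail s hβ
    · have hshift : ∀ k, (∀ i < β.length, k < i → entry β i = entry γ (i - 1)) ↔
          ∀ i < (b :: β).length, k + 1 < i → entry (b :: β) i = entry (g :: γ) (i - 1) := by
        intro k
        constructor
        · intro hk i hi hki
          obtain ⟨i, rfl⟩ : ∃ i', i = i' + 2 := ⟨i - 2, by omega⟩
          have := hk (i + 1) (by rw [List.length_cons] at hi; omega) (by omega)
          rwa [entry_cons_succ, show i + 2 - 1 = i + 1 from rfl, entry_cons_succ]
        · intro hk i hi hki
          obtain ⟨i, rfl⟩ : ∃ i', i = i' + 1 := ⟨i - 1, by omega⟩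
          have := hk (i + 2) (by rw [List.length_cons]; omega) (by omega)
          rwa [entry_cons_succ, show i + 2 - 1 = i + 1 from rfl, entry_cons_succ] at this
      have hne : ¬ (s ≠ 0 ∧ b = s ∧ β = g :: γ) := by
        rintro ⟨-, -, rfl⟩
        refine hmin 0 (Nat.succ_pos j) fun i _ hi0 => ?_
        obtain ⟨i, rfl⟩ : ∃ i', i = i' + 1 := ⟨i - 1, by omega⟩
        rw [entry_cons_succ, Nat.add_sub_cancel]
      simp only [List.forall_mem_cons] at hγ hβ
      have hmem := mem_Z_succ (s := s) (k := β.length) (b := b) hγ.1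
        (fun i => entry (b :: β) i) (fun i => if i.1 < j + 1 then
          entry (b :: β) i - entry (g :: γ) i else if i.1 = j + 1 then entry (b :: β) i else 0)
        rfl rfl
      have hsgn := pieriSign_mul_sgn (s := s) (k := j) (b := b) (g := g)
        (fun i => entry (b :: β) i - entry (g :: γ) i) rfl
      simp only [Fin.val_succ, entry_cons_succ, Nat.add_lt_add_iff_right, Nat.add_right_cancel_iff]
        at hmem hsgn
      rw [pieriRec_cons_cons, if_neg hne, zero_add, List.drop_succ_cons]
      refine Eq.trans ?_ (if_congr (and_congr Iff.rfl hmem.symm) rfl rfl)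
      rw [ih _ hγ.2 hβ.2 hlen ((hshift j).2 hj) fun k hk h' =>
        hmin (k + 1) (by omega) ((hshift k).1 h')]
      by_cases h1 : b ≤ s + g
      · rw [if_pos h1]
        by_cases h2 : pieriSign s b g = 0
        · simp [h2]
        · rw [mul_ite, mul_zero, hsgn h2]
          simp [h1, h2]
      · simp [h1]

theorem rIndex_sub_jIndex {n m : ℕ} (γ : Composition n) (α : Composition m)
    (h : jIndex γ α < α.length) :
    rIndex γ α - jIndex γ α = ascents (α.blocks.drop (jIndex γ α)) := by
  set j := jIndex γ α
  set a := ascents (α.blocks.drop j)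
  have hlen : (α.blocks.drop j).length = α.length - j := by simp
  have hne : α.blocks.drop j ≠ [] := by
    rw [← List.length_pos_iff, hlen]
    omega
  have ha : a < α.length - j := hlen ▸ ascents_lt hne
  have hpart : ∀ i, part α (j + i) = entry (α.blocks.drop j) i := fun i => (entry_drop _ _ _).symm
  suffices rIndex γ α = j + a by omega
  rw [rIndex, Nat.findGreatest_eq_iff]
  refine ⟨by omega, fun _ => ⟨Nat.le_add_right _ _, fun i hi hji => ?_⟩, fun k hk hk' hP => ?_⟩
  · obtain ⟨i, rfl⟩ := Nat.exists_eq_add_of_le hji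
    rw [add_assoc, hpart, hpart]
    exact entry_lt_of_lt_ascents (Nat.add_lt_add_iff_left.1 hi)
  · have := hP.2 (j + a) hk (Nat.le_add_right _ _)
    rw [add_assoc, hpart, hpart] at this
    exact not_entry_ascents_lt (by rw [hlen]; change a + 1 < _; omega) this

theorem pieriCoeff_eq_pieriRec {n s : ℕ} (α : Composition n) (β : Composition (n + s)) :
    pieriCoeff α β = pieriRec s α.blocks β.blocks := by
  have hα : ∀ b ∈ α.blocks, 0 < b := fun b hb => α.blocks_pos hb
  have hβ : ∀ b ∈ β.blocks, 0 < b := fun b hb => β.blocks_pos hb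
  rw [pieriCoeff]
  by_cases h1 : α.length = β.length
  · have h2 : ¬ β.length + 1 = β.length := by omega
    rw [pieriRec_of_length_eq s hα h1]
    simp only [h1, h2, true_and, false_and, if_false]
    congr
  · by_cases h2 : α.length + 1 = β.length
    · have hj : ∀ i < β.blocks.length, jIndex α β < i →
          entry β.blocks i = entry α.blocks (i - 1) :=
        Nat.find_spec (p := fun j => ∀ i < β.length, j < i → part β i = part α (i - 1)) _
      have hmin : ∀ k < jIndex α β, ¬ ∀ i < β.blocks.length, k < i →
          entry β.blocks i = entry α.blocks (i - 1) := fun k hk => Nat.find_min _ hk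
      have hlt : jIndex α β < β.length := by
        -- The condition defining `jIndex` is void at the last index.
        refine lt_of_le_of_lt (Nat.find_min' _ (m := β.length - 1) fun i hi hi' => ?_) (by omega)
        omega
      rw [pieriRec_of_length_succ s hα hβ h2 hj hmin, ← rIndex_sub_jIndex α β hlt]
      simp only [h1, h2, true_and, false_and, if_false]
      congr
    · rw [pieriRec_eq_zero s h1 h2]
      simp only [h1, h2, false_and, if_false]

end PieriCoefficient

end DualImmaculate

/-! ### The Pieri rule -/

theorem corollary4 (R : Type*) [CommRing R] {n s : ℕ} (hs : 0 < s) (α : Composition n) :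
    DualImmaculate.fundamental R (Composition.ones s) *
        DualImmaculate.rowStrictDualImmaculate R α =
      ∑ β : Composition (n + s) with α.length ≤ β.length ∧ β.length ≤ α.length + 1,
        DualImmaculate.pieriCoeff α β • DualImmaculate.rowStrictDualImmaculate R β := by
  rw [DualImmaculate.fundamental_ones_mul_rowStrictDualImmaculate]
  symm
  rw [Finset.sum_filter]
  refine Finset.sum_congr rfl fun β _ => ?_
  rw [DualImmaculate.pieriCoeff_eq_pieriRec]
  split_ifs with h
  · rfl
  · rw [DualImmaculate.pieriRec_eq_zero, zero_smul]
    · rw [α.blocks_length, β.blocks_length]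
      omega
    · rw [α.blocks_length, β.blocks_length]
      omega
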